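/- **Model.** Let $\mathcal A,\mathcal S_e,\mathcal S,\mathcal S_d,\mathcal X,\mathcal Y,\mathcal Z,\hat{\mathcal S}$ be arbitrary measurable spaces (alphabets), with $\mathcal X$ standard Borel. For each block length $n$ let $P_{S_e^nS^nS_d^n|A^n}$ be an arbitrary Markov kernel from $\mathcal A^n$ to $\mathcal S_e^n\times\mathcal S^n\times\mathcal S_d^n$, let $P_{Y^nZ^n|X^nS^n}$ be an arbitrary Markov kernel from $\mathcal X^n\times\mathcal S^n$ to $\mathcal Y^n\times\mathcal Z^n$ (no stationarity, ergodicity or memorylessness is assumed), and let $d_n:\mathcal S^n\times\hat{\mathcal S}^n\to[0,\infty)$ be measurable. The distortion functions are uniformly bounded: there is $D_{\max}>0$ with $\frac1n d_n\le D_{\max}$ for all $n\ge1$. **Codes.** A code of length $n$ consists of a finite nonempty message set $\mathcal M_n$, a set $\mathcal A_n\subseteq\mathcal A^n$ of action sequences, an action encoder $f_A:\mathcal M_n\to\mathcal A_n$, and measurable maps: a message encoder $f:\mathcal M_n\times\mathcal S_e^n\to\mathcal X^n$, a decoder $h:\mathcal Y^n\times\mathcal S_d^n\to\mathcal M_n$,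 and a state estimator $g_n:\mathcal X^n\times\mathcal A^n\times\mathcal S_e^n\times\mathcal Z^n\to\hat{\mathcal S}^n$. With $M$ uniform on $\mathcal M_n$, $A^n=f_A(M)$, $X^n=f(M,S_e^n)$, let $P_{e,n}=\Pr\{h(Y^n,S_d^n)\ne M\}$. For real $R,D$, the pair $(R,D)$ is $a$-achievable if for every $\epsilon>0$ there is a sequence of codes with $$\liminf_{n\to\infty}\tfrac1n\log|\mathcal M_n|\ge R,\qquad \limsup_{n\to\infty}P_{e,n}\le\epsilon,\qquad \limsup_{n\to\infty}\tfrac1n\mathbb E\big[d_n(S^n,g_n(X^n,A^n,S_e^n,Z^n))\big]\le D,$$ and $C_a(D)\in[-\infty,\infty]$ is the supremum of all $R$ such that $(R,D)$ is $a$-achievable. **Information rates.** For extended-real random variables $T_n$ let $\mathrm{p}\text{-}\limsup T_n=\inf\{\alpha:\Pr\{T_n>\alpha\}\to0\}$ and $\mathrm{p}\text{-}\liminf T_n=\sup\{\beta:\Pr\{T_n<\beta\}\to0\}$. Put $$\underline I(\boldsymbol B;\boldsymbol C)=\mathrm{p}\text{-}\liminf_{n\to\infty}\tfrac1n\log\frac{dP_{B^nC^n}}{d(P_{B^n}\times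 P_{C^n})}(B^n,C^n),\qquad \overline I(\boldsymbol U;\boldsymbol S_e|\boldsymbol A)=\mathrm{p}\text{-}\limsup_{n\to\infty}\tfrac1n\log\frac{dP_{A^nS_e^nU^n}}{d(P_{A^n}P_{S_e^n|A^n}P_{U^n|A^n})}(A^n,S_e^n,U^n),$$ where a likelihood ratio is $+\infty$ on the part of the numerator that is singular with respect to the denominator. **Theorem.** For every $D\in\mathbb R$, $$C_a(D)=\sup_{\mathcal P_D}\big[\underline I(\boldsymbol A,\boldsymbol U;\boldsymbol Y,\boldsymbol S_d)-\overline I(\boldsymbol U;\boldsymbol S_e|\boldsymbol A)\big]=\sup_{\mathcal P_D}\big[\underline I(\boldsymbol U;\boldsymbol Y,\boldsymbol S_d)-\overline I(\boldsymbol U;\boldsymbol S_e|\boldsymbol A)\big],$$ where $\mathcal P_D$ is the set of all processes, with an arbitrary measurable auxiliary alphabet $\mathcal U$, for which for every $n$ the variables $(A^n,S_e^n,S^n,S_d^n,U^n,X^n,Y^n,Z^n)$ have the joint law $$P_{A^n}\,P_{S_e^nS^nS_d^n|A^n}\,P_{U^n|A^nS_e^n}\,P_{X^n|U^nS_e^n}\,P_{Y^nZ^n|X^nS^n},$$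 and for which some sequence of measurable maps $g_n:\mathcal X^n\times\mathcal A^n\times\mathcal S_e^n\times\mathcal Z^n\to\hat{\mathcal S}^n$ satisfies $\limsup_{n\to\infty}\frac1n\mathbb E[d_n(S^n,g_n(X^n,A^n,S_e^n,Z^n))]\le D$. Here $\infty-\infty:=-\infty$ and $\sup\emptyset:=-\infty$. -/

import Mathlib

open MeasureTheory ProbabilityTheory Filter Topology

noncomputable section

namespace ISAC

/-- The `n`-fold Cartesian power of an alphabet. -/
abbrev Seq (α : Type*) (n : ℕ) : Type _ := Fin n → α

/-! ### Information-spectrum quantities -/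

/-- Limit superior in probability of a sequence of extended real random variables `T n`, each
living on its own probability space `(Ω n, μ n)`. -/
def pLimsup {Ω : ℕ → Type*} [∀ n, MeasurableSpace (Ω n)] (μ : ∀ n, Measure (Ω n))
    (T : ∀ n, Ω n → EReal) : EReal :=
  sInf {α : EReal | Tendsto (fun n => μ n {ω | α < T n ω}) atTop (𝓝 0)}

/-- Limit inferior in probability. -/
def pLiminf {Ω : ℕ → Type*} [∀ n, MeasurableSpace (Ω n)] (μ : ∀ n, Measure (Ω n))
    (T : ∀ n, Ω n → EReal) : EReal :=
  sSup {β : EReal | Tendsto (fun n => μ n {ω | T n ω < β}) atTop (𝓝 0)}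

/-- The logarithm of the likelihood ratio `dμ/dν`. It is computed through the dominating measure
`μ + ν`, so that it equals `+∞` at `μ`-almost every point of the part of `μ` that is singular
with respect to `ν`. -/
def logRatio {Ω : Type*} [MeasurableSpace Ω] (μ ν : Measure Ω) (ω : Ω) : EReal :=
  ENNReal.log (μ.rnDeriv (μ + ν) ω / ν.rnDeriv (μ + ν) ω)

/-- Spectral inf-mutual information rate of a sequence of joint laws of `(B^n, C^n)`: the limit
inferior in probability of `(1/n) log (dP_{BC} / d(P_B × P_C))`. -/
def spectralInfMutual {β γ : ℕ → Type*} [∀ n, MeasurableSpace (β n)]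
    [∀ n, MeasurableSpace (γ n)] (P : ∀ n, Measure (β n × γ n)) : EReal :=
  pLiminf P fun n ω => ((1 / (n : ℝ) : ℝ) : EReal) *
    logRatio (P n) ((P n).fst.prod (P n).snd) ω

/-- Spectral sup-conditional mutual information rate between `B^n` and `C^n` given `A^n`, where
`A^n ∼ P n`, `C^n ∼ K n` given `A^n`, and `B^n ∼ κ n` given `(A^n, C^n)`: the limit superior in
probability of `(1/n) log (P_{B|AC} / P_{B|A})`, that is of the likelihood ratio between the joint
law `P_A P_{C|A} P_{B|AC}` and `P_A P_{C|A} P_{B|A}`. -/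
def spectralSupCondMutual {α β γ : ℕ → Type*} [∀ n, MeasurableSpace (α n)]
    [∀ n, MeasurableSpace (β n)] [∀ n, MeasurableSpace (γ n)]
    (P : ∀ n, Measure (α n)) (K : ∀ n, Kernel (α n) (γ n))
    (κ : ∀ n, Kernel (α n × γ n) (β n)) : EReal :=
  pLimsup (fun n => P n ⊗ₘ (K n ⊗ₖ κ n)) fun n ω => ((1 / (n : ℝ) : ℝ) : EReal) *
    logRatio (P n ⊗ₘ (K n ⊗ₖ κ n)) (P n ⊗ₘ (K n ×ₖ (K n ⊗ₖ κ n).snd)) ω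

/-! ### The model -/

/-- A general action-dependent integrated sensing and communication model, with action alphabet
`𝒜`, encoder-side, true and decoder-side state alphabets `Se`, `S`, `Sd`, input alphabet `𝒳`,
output alphabet `𝒴`, feedback alphabet `𝒵` and reconstruction alphabet `Sh`. -/
structure Model (𝒜 Se S Sd 𝒳 𝒴 𝒵 Sh : Type*) [MeasurableSpace 𝒜] [MeasurableSpace Se]
    [MeasurableSpace S] [MeasurableSpace Sd] [MeasurableSpace 𝒳] [MeasurableSpace 𝒴]
    [MeasurableSpace 𝒵] [MeasurableSpace Sh] where
  /-- the law of `(S_e^n, S^n, S_d^n)` given `A^n` -/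
  state : ∀ n, Kernel (Seq 𝒜 n) (Seq Se n × Seq S n × Seq Sd n)
  state_markov : ∀ n, IsMarkovKernel (state n)
  /-- the law of `(Y^n, Z^n)` given `(X^n, S^n)` -/
  channel : ∀ n, Kernel (Seq 𝒳 n × Seq S n) (Seq 𝒴 n × Seq 𝒵 n)
  channel_markov : ∀ n, IsMarkovKernel (channel n)
  /-- the distortion functions `d_n` -/
  dist : ∀ n, Seq S n → Seq Sh n → ℝ
  dist_nonneg : ∀ n s t, 0 ≤ dist n s t
  dist_measurable : ∀ n, Measurable (fun p : Seq S n × Seq Sh n => dist n p.1 p.2)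

attribute [instance] Model.state_markov Model.channel_markov

variable {𝒜 Se S Sd 𝒳 𝒴 𝒵 Sh : Type*} [MeasurableSpace 𝒜] [MeasurableSpace Se]
  [MeasurableSpace S] [MeasurableSpace Sd] [MeasurableSpace 𝒳] [MeasurableSpace 𝒴]
  [MeasurableSpace 𝒵] [MeasurableSpace Sh]

/-- The distortion functions are uniformly bounded: `(1/n) d_n ≤ D_max` for all `n ≥ 1`. -/
def Model.UniformlyBounded (M : Model 𝒜 Se S Sd 𝒳 𝒴 𝒵 Sh) : Prop :=
  ∃ Dmax : ℝ, 0 < Dmax ∧ ∀ n : ℕ, 1 ≤ n → ∀ s t, 1 / (n : ℝ) * M.dist n s t ≤ Dmax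

/-! ### Codes and capacity -/

/-- A code of block length `n` for the model; the message set is `{0, …, size - 1}`. -/
structure Code (M : Model 𝒜 Se S Sd 𝒳 𝒴 𝒵 Sh) (n : ℕ) where
  /-- the number of messages -/
  size : ℕ
  size_pos : 0 < size
  /-- the set of action sequences in use -/
  actionSet : Set (Seq 𝒜 n)
  /-- the action encoder -/
  actEnc : Fin size → actionSet
  /-- the message encoder -/
  enc : Fin size → Seq Se n → Seq 𝒳 n
  enc_measurable : ∀ m, Measurable (enc m)
  /-- the decoder -/
  dec : Seq 𝒴 n × Seq Sd n → Fin size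
  dec_measurable : Measurable dec
  /-- the state estimator, a function of `(X^n, A^n, S_e^n, Z^n)` -/
  est : Seq 𝒳 n × Seq 𝒜 n × Seq Se n × Seq 𝒵 n → Seq Sh n
  est_measurable : Measurable est

namespace Code

variable {M : Model 𝒜 Se S Sd 𝒳 𝒴 𝒵 Sh} {n : ℕ} (c : Code M n)

/-- The law of `((S_e^n, S^n, S_d^n), (Y^n, Z^n))` when the message `m` is sent. -/
def outLaw (m : Fin c.size) :
    Measure ((Seq Se n × Seq S n × Seq Sd n) × (Seq 𝒴 n × Seq 𝒵 n)) :=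
  M.state n (c.actEnc m) ⊗ₘ
    (M.channel n).comap (fun p : Seq Se n × Seq S n × Seq Sd n => (c.enc m p.1, p.2.1))
      (by have := c.enc_measurable m; fun_prop)

/-- The average probability of a decoding error. -/
def errorProb : ℝ :=
  1 / (c.size : ℝ) * ∑ m, (c.outLaw m).real {ω | c.dec (ω.2.1, ω.1.2.2) ≠ m}

/-- The expected distortion `E[d_n(S^n, g_n(f(M, S_e^n), f_A(M), S_e^n, Z^n))]` for a uniformly
distributed message. -/
def expDistortion : ℝ :=
  1 / (c.size : ℝ) * ∑ m, ∫ ω,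
    M.dist n ω.1.2.1 (c.est (c.enc m ω.1.1, (c.actEnc m : Seq 𝒜 n), ω.1.1, ω.2.2)) ∂(c.outLaw m)

end Code

/-- The rate-distortion pair `(R, D)` is achievable under the average distortion constraint. -/
def Model.AvgAchievable (M : Model 𝒜 Se S Sd 𝒳 𝒴 𝒵 Sh) (R D : ℝ) : Prop :=
  ∀ ε : ℝ, 0 < ε → ∃ c : ∀ n, Code M n,
    (R : EReal) ≤ liminf (fun n : ℕ => ((1 / (n : ℝ) * Real.log (c n).size : ℝ) : EReal)) atTop ∧
    limsup (fun n => ((c n).errorProb : EReal)) atTop ≤ (ε : EReal) ∧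
    limsup (fun n : ℕ => ((1 / (n : ℝ) * (c n).expDistortion : ℝ) : EReal)) atTop ≤ (D : EReal)

/-- The capacity-distortion function under the average distortion constraint: the supremum of the
rates `R` for which `(R, D)` is achievable, in the extended reals (`-∞` if there is none). -/
def Model.avgCapacity (M : Model 𝒜 Se S Sd 𝒳 𝒴 𝒵 Sh) (D : ℝ) : EReal :=
  sSup {r : EReal | ∃ R : ℝ, M.AvgAchievable R D ∧ r = R}

/-! ### The processes over which the formula is optimized -/

/-- The free ingredients of a random process whose `n`-th collection of variables is distributed as
`P_A P_{S_e S S_d|A} P_{U|A S_e} P_{X|U S_e} P_{YZ|XS}`, with an auxiliary alphabet `𝒰`, together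
with a sequence of reconstruction functions. -/
structure AuxProcess (M : Model 𝒜 Se S Sd 𝒳 𝒴 𝒵 Sh) (𝒰 : Type*) [MeasurableSpace 𝒰] where
  /-- the law of `A^n` -/
  act : ∀ n, Measure (Seq 𝒜 n)
  act_prob : ∀ n, IsProbabilityMeasure (act n)
  /-- the law of `U^n` given `(A^n, S_e^n)` -/
  aux : ∀ n, Kernel (Seq 𝒜 n × Seq Se n) (Seq 𝒰 n)
  aux_markov : ∀ n, IsMarkovKernel (aux n)
  /-- the law of `X^n` given `(U^n, S_e^n)` -/
  inp : ∀ n, Kernel (Seq 𝒰 n × Seq Se n) (Seq 𝒳 n)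
  inp_markov : ∀ n, IsMarkovKernel (inp n)
  /-- the reconstruction functions `g_n(X^n, A^n, S_e^n, Z^n)` -/
  est : ∀ n, Seq 𝒳 n × Seq 𝒜 n × Seq Se n × Seq 𝒵 n → Seq Sh n
  est_measurable : ∀ n, Measurable (est n)

attribute [instance] AuxProcess.act_prob AuxProcess.aux_markov AuxProcess.inp_markov

namespace AuxProcess

variable {M : Model 𝒜 Se S Sd 𝒳 𝒴 𝒵 Sh} {𝒰 : Type*} [MeasurableSpace 𝒰] (p : AuxProcess M 𝒰)

/-- The joint law of `((((A^n, (S_e^n, S^n, S_d^n)), U^n), X^n), (Y^n, Z^n))`. -/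
def jointLaw (n : ℕ) :
    Measure ((((Seq 𝒜 n × (Seq Se n × Seq S n × Seq Sd n)) × Seq 𝒰 n) × Seq 𝒳 n) ×
      (Seq 𝒴 n × Seq 𝒵 n)) :=
  (((p.act n ⊗ₘ M.state n)
    ⊗ₘ (p.aux n).comap
      (fun ω : Seq 𝒜 n × (Seq Se n × Seq S n × Seq Sd n) => (ω.1, ω.2.1)) (by fun_prop))
    ⊗ₘ (p.inp n).comap
      (fun ω : (Seq 𝒜 n × (Seq Se n × Seq S n × Seq Sd n)) × Seq 𝒰 n => (ω.2, ω.1.2.1))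
      (by fun_prop))
    ⊗ₘ (M.channel n).comap
      (fun ω : ((Seq 𝒜 n × (Seq Se n × Seq S n × Seq Sd n)) × Seq 𝒰 n) × Seq 𝒳 n =>
        (ω.2, ω.1.1.2.2.1)) (by fun_prop)

/-- The expected distortion `E[d_n(S^n, g_n(X^n, A^n, S_e^n, Z^n))]`. -/
def expDistortion (n : ℕ) : ℝ :=
  ∫ ω, M.dist n ω.1.1.1.2.2.1 (p.est n (ω.1.2, ω.1.1.1.1, ω.1.1.1.2.1, ω.2.2)) ∂(p.jointLaw n)

/-- The average distortion constraint. -/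
def MeetsDistortion (D : ℝ) : Prop :=
  limsup (fun n : ℕ => ((1 / (n : ℝ) * p.expDistortion n : ℝ) : EReal)) atTop ≤ (D : EReal)

/-- The spectral inf-mutual information rate between `(A, U)` and `(Y, S_d)`. -/
def infRateActAux : EReal :=
  spectralInfMutual fun n => (p.jointLaw n).map
    fun ω => ((ω.1.1.1.1, ω.1.1.2), (ω.2.1, ω.1.1.1.2.2.2))

/-- The spectral inf-mutual information rate between `U` and `(Y, S_d)`. -/
def infRateAux : EReal :=
  spectralInfMutual fun n => (p.jointLaw n).map
    fun ω => (ω.1.1.2, (ω.2.1, ω.1.1.1.2.2.2))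

/-- The spectral sup-conditional mutual information rate between `U` and `S_e` given `A`. -/
def supRateCond : EReal :=
  spectralSupCondMutual p.act (fun n => (M.state n).fst) p.aux

end AuxProcess

end ISAC

end

/-!
# The general capacity-distortion formula

With `a`, `b`, `c` the capacity and the two suprema, in the order of the theorem, the proof is the
cycle `a ≤ c ≤ b ≤ a`. It uses no structure of the state and channel laws: apart from measurability,
everything rests on two changes of measure between `μ` and `ν`, on the set where the log-likelihood
ratio is at most `t` (`measure_inter_logRatio_le`) or at least `t` (`measure_inter_le_logRatio`).

*Achievability*, `b ≤ a`. Let `t` exceed the conditional rate and let `β` lie below the information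
rate of `(A, U)` and `(Y, S_d)`. A codeword is an action sequence `A` together with a list of `exp
(n t')` sequences, `t' > t`, that are conditionally i.i.d. with law `P_{U|A}`. The encoder observes
`S_e` and selects from the list by rejection sampling: where the likelihood ratio of `P_{U|A S_e}`
and `P_{U|A}` is at most `exp (n t)`, a proposal can be accepted with a probability that turns
`P_{U|A}` into `exp (-n t) P_{U|A S_e}`, and the list is long enough for some proposal to be
accepted. The induced law of all variables thus dominates the law of the process, restricted to a
set of probability close to one, up to a factor close to one (`exists_covering`,
`AuxProcess.exists_ensemble`). Nothing is disintegrated on the alphabet of `U`, which may therefore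
be arbitrary; that of `X` is standard Borel so that `P_{X|U S_e}` can be realized by a map of `(U,
S_e)` and of a uniform variable. This variable, and the one that decides about acceptance, are
carried by the list entries, so that the encoder becomes deterministic once the codebook is fixed.
The decoder looks for the unique message whose list has an entry with likelihood ratio at least `exp
(n β)`; the union bound over messages and list entries allows every rate below `β - t'`
(`exists_codebook`). Finally, one codebook has to be good for both criteria although the distortion
must not exceed `D` by a constant factor. The mean of `w * error + distortion` over the ensemble
bounds that of some codebook, with a weight `w` that is so large that the error probability
vanishes, because the distortion is bounded, and so small that `w` times the mean error probability
is `o(n)` (`AuxProcess.avgAchievable_of_lt`).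

*Converse*, `a ≤ c`. A diagonal sequence of codes has vanishing error probability
(`Model.AvgAchievable.exists_codes`). Take the message as `U` (`codeProcess`). It is independent
of `S_e` given `A`, which makes the conditional rate nonpositive, and the distortion is that of
the codes. The information rate of `U` and `(Y, S_d)` is at least the code rate by the
Verdú–Han argument: under the product law the decoder guesses a uniform message with probability
`1 / size`, so that the joint law gives little mass to the set where the guess is right and the
likelihood ratio is well below `size` (`measure_logRatio_le_le`).

The inequality `c ≤ b` is data processing (`spectralInfMutual_map_le`).
-/

namespace ISAC

open scoped ENNReal unitInterval

/-! ### Likelihood ratios -/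

section LogRatio

variable {Ω : Type*} [MeasurableSpace Ω]

lemma measurable_logRatio (μ ν : Measure Ω) : Measurable (logRatio μ ν) :=
  ((Measure.measurable_rnDeriv _ _).div (Measure.measurable_rnDeriv _ _)).ennreal_log

lemma log_ofReal_exp (t : ℝ) : ENNReal.log (ENNReal.ofReal (Real.exp t)) = t := by
  rw [ENNReal.log_ofReal_of_pos (Real.exp_pos t), Real.log_exp]

/-- Change of measure: where the likelihood ratio `dμ/dν` is at most `exp t`, the measure `μ` is
dominated by `exp t • ν`. -/
lemma measure_inter_logRatio_le (μ ν : Measure Ω) [IsFiniteMeasure μ] [IsFiniteMeasure ν] (t : ℝ)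
    (E : Set Ω) :
    μ (E ∩ {ω | logRatio μ ν ω ≤ t}) ≤ ENNReal.ofReal (Real.exp t) * ν E := by
  have hm : MeasurableSet {ω | logRatio μ ν ω ≤ t} :=
    measurableSet_le (measurable_logRatio μ ν) measurable_const
  have hμ : μ ≪ μ + ν := (Measure.le_add_right le_rfl).absolutelyContinuous
  have hν : ν ≪ μ + ν := (Measure.le_add_left le_rfl).absolutelyContinuous
  calc μ (E ∩ {ω | logRatio μ ν ω ≤ t})
      = ∫⁻ ω in E ∩ {ω | logRatio μ ν ω ≤ t}, μ.rnDeriv (μ + ν) ω ∂(μ + ν) :=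
        (Measure.setLIntegral_rnDeriv hμ _).symm
    _ ≤ ∫⁻ ω in E ∩ {ω | logRatio μ ν ω ≤ t},
          ENNReal.ofReal (Real.exp t) * ν.rnDeriv (μ + ν) ω ∂(μ + ν) := by
        refine setLIntegral_mono_ae (by fun_prop) ?_
        filter_upwards [Measure.rnDeriv_lt_top ν (μ + ν)] with ω hω h
        have h2 : μ.rnDeriv (μ + ν) ω / ν.rnDeriv (μ + ν) ω ≤ ENNReal.ofReal (Real.exp t) := by
          rw [← ENNReal.log_le_log_iff, log_ofReal_exp]
          exact h.2
        rwa [ENNReal.div_le_iff_le_mul (Or.inr ENNReal.ofReal_ne_top) (Or.inl hω.ne)] at h2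
    _ = ENNReal.ofReal (Real.exp t) * ν (E ∩ {ω | logRatio μ ν ω ≤ t}) := by
        rw [lintegral_const_mul _ (Measure.measurable_rnDeriv _ _),
          Measure.setLIntegral_rnDeriv hν]
    _ ≤ _ := by gcongr; exact Set.inter_subset_left

/-- Change of measure in the other direction: where `dμ/dν` is at least `exp t`, the measure `ν` is
dominated by `exp (-t) • μ`. -/
lemma measure_inter_le_logRatio (μ ν : Measure Ω) [IsFiniteMeasure μ] [IsFiniteMeasure ν] (t : ℝ)
    (E : Set Ω) :
    ν (E ∩ {ω | t ≤ logRatio μ ν ω}) ≤ ENNReal.ofReal (Real.exp (-t)) * μ E := by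
  have hm : MeasurableSet {ω | t ≤ logRatio μ ν ω} :=
    measurableSet_le measurable_const (measurable_logRatio μ ν)
  have hμ : μ ≪ μ + ν := (Measure.le_add_right le_rfl).absolutelyContinuous
  have hν : ν ≪ μ + ν := (Measure.le_add_left le_rfl).absolutelyContinuous
  calc ν (E ∩ {ω | t ≤ logRatio μ ν ω})
      = ∫⁻ ω in E ∩ {ω | t ≤ logRatio μ ν ω}, ν.rnDeriv (μ + ν) ω ∂(μ + ν) :=
        (Measure.setLIntegral_rnDeriv hν _).symm
    _ ≤ ∫⁻ ω in E ∩ {ω | t ≤ logRatio μ ν ω},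
          ENNReal.ofReal (Real.exp (-t)) * μ.rnDeriv (μ + ν) ω ∂(μ + ν) := by
        refine setLIntegral_mono_ae (by fun_prop) ?_
        filter_upwards with ω h
        have h2 : ENNReal.ofReal (Real.exp t) ≤ μ.rnDeriv (μ + ν) ω / ν.rnDeriv (μ + ν) ω := by
          rw [← ENNReal.log_le_log_iff, log_ofReal_exp]
          exact h.2
        have h3 := ENNReal.mul_le_of_le_div h2
        rw [Real.exp_neg, ENNReal.ofReal_inv_of_pos (Real.exp_pos t), mul_comm,
          ← div_eq_mul_inv, ENNReal.le_div_iff_mul_le (by simp [Real.exp_pos]) (by simp),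
          mul_comm]
        exact h3
    _ = ENNReal.ofReal (Real.exp (-t)) * μ (E ∩ {ω | t ≤ logRatio μ ν ω}) := by
        rw [lintegral_const_mul _ (Measure.measurable_rnDeriv _ _),
          Measure.setLIntegral_rnDeriv hμ]
    _ ≤ _ := by gcongr; exact Set.inter_subset_left

end LogRatio

/-! ### Information spectra -/

lemma one_div_mul_le_coe_iff {n : ℕ} (hn : 1 ≤ n) (x : EReal) (b : ℝ) :
    ((1 / (n : ℝ) : ℝ) : EReal) * x ≤ b ↔ x ≤ ((n * b : ℝ) : EReal) := by
  have hn' : (0 : ℝ) < n := by exact_mod_cast hn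
  have hp : (0 : ℝ) < 1 / n := by positivity
  induction x with
  | bot =>
    rw [EReal.coe_mul_bot_of_pos hp]
    simp only [bot_le]
  | coe x =>
    rw [← EReal.coe_mul, EReal.coe_le_coe_iff, EReal.coe_le_coe_iff, one_div,
      inv_mul_le_iff₀ hn']
  | top =>
    rw [EReal.coe_mul_top_of_pos hp]
    simp only [top_le_iff, EReal.coe_ne_top]

lemma coe_le_one_div_mul_iff {n : ℕ} (hn : 1 ≤ n) (x : EReal) (b : ℝ) :
    (b : EReal) ≤ ((1 / (n : ℝ) : ℝ) : EReal) * x ↔ ((n * b : ℝ) : EReal) ≤ x := by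
  have hn' : (0 : ℝ) < n := by exact_mod_cast hn
  have hp : (0 : ℝ) < 1 / n := by positivity
  induction x with
  | bot =>
    rw [EReal.coe_mul_bot_of_pos hp]
    simp only [le_bot_iff, EReal.coe_ne_bot]
  | coe x =>
    rw [← EReal.coe_mul, EReal.coe_le_coe_iff, EReal.coe_le_coe_iff, one_div,
      le_inv_mul_iff₀ hn']
  | top =>
    rw [EReal.coe_mul_top_of_pos hp]
    simp only [le_top]

lemma tendsto_ofReal_exp_neg_mul {c : ℝ} (hc : 0 < c) :
    Tendsto (fun n : ℕ => ENNReal.ofReal (Real.exp (-(n * c)))) atTop (𝓝 0) := by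
  have h : Tendsto (fun n : ℕ => Real.exp (-((n : ℝ) * c))) atTop (𝓝 0) :=
    Real.tendsto_exp_neg_atTop_nhds_zero.comp
      (tendsto_natCast_atTop_atTop.atTop_mul_const hc)
  simpa using ENNReal.tendsto_ofReal h

lemma measurable_rate_logRatio {Ω : Type*} [MeasurableSpace Ω] (μ ν : Measure Ω) (n : ℕ) :
    Measurable fun ω => ((1 / (n : ℝ) : ℝ) : EReal) * logRatio μ ν ω := by
  have := measurable_logRatio μ ν
  fun_prop

section Spectrum

variable {Ω : ℕ → Type*} [∀ n, MeasurableSpace (Ω n)]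

/-- A normalized log-likelihood ratio `(1/n) log (dμ/dν)` of probability measures has a nonnegative
limit superior in probability under the numerator. -/
lemma pLimsup_logRatio_nonneg (μ ν : ∀ n, Measure (Ω n)) [∀ n, IsProbabilityMeasure (μ n)]
    [∀ n, IsProbabilityMeasure (ν n)] :
    0 ≤ pLimsup μ fun n ω => ((1 / (n : ℝ) : ℝ) : EReal) * logRatio (μ n) (ν n) ω := by
  refine le_sInf fun α hα => ?_
  by_contra! hneg
  obtain ⟨r, hr1, hr2⟩ := EReal.lt_iff_exists_real_btwn.1 hneg
  have hr : 0 < -r := by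
    have : r < 0 := by exact_mod_cast hr2
    linarith
  have hle : ∀ᶠ n : ℕ in atTop, 1 ≤
      μ n {ω | α < ((1 / (n : ℝ) : ℝ) : EReal) * logRatio (μ n) (ν n) ω} +
        ENNReal.ofReal (Real.exp (-(n * -r))) := by
    filter_upwards [eventually_ge_atTop 1] with n hn
    calc 1 = μ n Set.univ := measure_univ.symm
      _ ≤ μ n ({ω | α < ((1 / (n : ℝ) : ℝ) : EReal) * logRatio (μ n) (ν n) ω} ∪
            (Set.univ ∩ {ω | logRatio (μ n) (ν n) ω ≤ ((n * r : ℝ) : EReal)})) := by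
          refine measure_mono fun ω _ => ?_
          by_cases h : α < ((1 / (n : ℝ) : ℝ) : EReal) * logRatio (μ n) (ν n) ω
          · exact Or.inl h
          · exact Or.inr ⟨trivial, (one_div_mul_le_coe_iff hn _ _).1 ((not_lt.1 h).trans hr1.le)⟩
      _ ≤ _ := (measure_union_le _ _).trans (by
          gcongr
          refine (measure_inter_logRatio_le _ _ _ Set.univ).trans ?_
          simp)
  have hlim := hα.add (tendsto_ofReal_exp_neg_mul hr)
  rw [add_zero] at hlim
  exact absurd (ge_of_tendsto hlim hle) (by simp)

lemma pLimsup_logRatio_self_nonpos (μ : ∀ n, Measure (Ω n)) [∀ n, IsProbabilityMeasure (μ n)] :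
    pLimsup μ (fun n ω => ((1 / (n : ℝ) : ℝ) : EReal) * logRatio (μ n) (μ n) ω) ≤ 0 := by
  refine le_of_forall_gt fun c hc => ?_
  obtain ⟨r, hr1, hr2⟩ := EReal.lt_iff_exists_real_btwn.1 hc
  have hr : 0 < r := by exact_mod_cast hr1
  refine lt_of_le_of_lt (sInf_le ?_) hr2
  refine tendsto_of_tendsto_of_tendsto_of_le_of_le' tendsto_const_nhds
    (tendsto_ofReal_exp_neg_mul hr) (Eventually.of_forall fun _ => zero_le) ?_
  filter_upwards [eventually_ge_atTop 1] with n hn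
  calc μ n {ω | (r : EReal) < ((1 / (n : ℝ) : ℝ) : EReal) * logRatio (μ n) (μ n) ω}
      ≤ μ n (Set.univ ∩ {ω | ((n * r : ℝ) : EReal) ≤ logRatio (μ n) (μ n) ω}) :=
        measure_mono fun ω hω => ⟨trivial, (coe_le_one_div_mul_iff hn _ _).1 hω.le⟩
    _ ≤ _ := (measure_inter_le_logRatio _ _ _ Set.univ).trans (by simp)

/-- Data processing for the spectral inf-mutual information rate: applying maps to the first
component does not increase it. -/
lemma spectralInfMutual_map_le {β β' γ : ℕ → Type*} [∀ n, MeasurableSpace (β n)]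
    [∀ n, MeasurableSpace (β' n)] [∀ n, MeasurableSpace (γ n)] (P : ∀ n, Measure (β n × γ n))
    [∀ n, IsProbabilityMeasure (P n)] (f : ∀ n, β n → β' n) (hf : ∀ n, Measurable (f n)) :
    spectralInfMutual (fun n => (P n).map (Prod.map (f n) id)) ≤ spectralInfMutual P := by
  have hF : ∀ n, Measurable (Prod.map (f n) (id : γ n → γ n)) := fun n =>
    (hf n).prodMap measurable_id
  have hP : ∀ n, IsProbabilityMeasure ((P n).map (Prod.map (f n) (id : γ n → γ n))) := fun n =>
    Measure.isProbabilityMeasure_map (hF n).aemeasurable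
  have hQ : ∀ n, ((P n).fst.prod (P n).snd).map (Prod.map (f n) id) =
      ((P n).map (Prod.map (f n) id)).fst.prod ((P n).map (Prod.map (f n) id)).snd := by
    intro n
    rw [← Measure.map_prod_map _ _ (hf n) measurable_id]
    congr 1
    · rw [Measure.fst, Measure.fst, Measure.map_map (hf n) measurable_fst,
        Measure.map_map measurable_fst (hF n)]
      rfl
    · rw [Measure.snd, Measure.snd, Measure.map_map measurable_id measurable_snd,
        Measure.map_map measurable_snd (hF n)]
      rfl
  refine sSup_le fun b hb => le_of_forall_lt fun c hc => ?_
  obtain ⟨r', hr1, hr2⟩ := EReal.lt_iff_exists_real_btwn.1 hc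
  obtain ⟨r, hr3, hr4⟩ := EReal.lt_iff_exists_real_btwn.1 hr2
  have hrr : 0 < r - r' := by
    have : r' < r := by exact_mod_cast hr3
    linarith
  refine lt_of_lt_of_le hr1 (le_sSup ?_)
  have hlim := Tendsto.add hb (tendsto_ofReal_exp_neg_mul hrr)
  rw [add_zero] at hlim
  refine tendsto_of_tendsto_of_tendsto_of_le_of_le' tendsto_const_nhds hlim
    (Eventually.of_forall fun _ => zero_le) ?_
  filter_upwards [eventually_ge_atTop 1] with n hn
  set P' := (P n).map (Prod.map (f n) (id : γ n → γ n))
  set Q := (P n).fst.prod (P n).snd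
  set Q' := P'.fst.prod P'.snd with hQ'
  have hEm : MeasurableSet {ω | ((n * r : ℝ) : EReal) ≤ logRatio P' Q' ω} :=
    measurableSet_le measurable_const (measurable_logRatio _ _)
  have hbm : MeasurableSet {ω | ((1 / (n : ℝ) : ℝ) : EReal) * logRatio P' Q' ω < b} :=
    measurableSet_lt (measurable_rate_logRatio _ _ n) measurable_const
  calc P n {ω | ((1 / (n : ℝ) : ℝ) : EReal) * logRatio (P n) Q ω < r'}
      ≤ P n (Prod.map (f n) id ⁻¹' {ω | ((1 / (n : ℝ) : ℝ) : EReal) * logRatio P' Q' ω < b} ∪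
          Prod.map (f n) id ⁻¹' {ω | ((n * r : ℝ) : EReal) ≤ logRatio P' Q' ω} ∩
            {ω | logRatio (P n) Q ω ≤ ((n * r' : ℝ) : EReal)}) := by
        refine measure_mono fun ω hω => ?_
        by_cases h : ((1 / (n : ℝ) : ℝ) : EReal) * logRatio P' Q' (Prod.map (f n) id ω) < b
        · exact Or.inl h
        · exact Or.inr ⟨(coe_le_one_div_mul_iff hn _ _).1 (hr4.le.trans (not_lt.1 h)),
            (one_div_mul_le_coe_iff hn _ _).1 (le_of_lt hω)⟩
    _ ≤ P' {ω | ((1 / (n : ℝ) : ℝ) : EReal) * logRatio P' Q' ω < b} +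
          ENNReal.ofReal (Real.exp (n * r')) *
            Q (Prod.map (f n) id ⁻¹' {ω | ((n * r : ℝ) : EReal) ≤ logRatio P' Q' ω}) := by
        refine (measure_union_le _ _).trans (add_le_add ?_ ?_)
        · rw [Measure.map_apply (hF n) hbm]
        · exact measure_inter_logRatio_le _ _ _ _
    _ ≤ P' {ω | ((1 / (n : ℝ) : ℝ) : EReal) * logRatio P' Q' ω < b} +
          ENNReal.ofReal (Real.exp (n * r')) * ENNReal.ofReal (Real.exp (-(n * r))) := by
        gcongr
        rw [← Measure.map_apply (hF n) hEm, hQ n]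
        have := measure_inter_le_logRatio P' Q' (n * r) Set.univ
        simpa using this
    _ = P' {ω | ((1 / (n : ℝ) : ℝ) : EReal) * logRatio P' Q' ω < b} +
          ENNReal.ofReal (Real.exp (-(n * (r - r')))) := by
        rw [← ENNReal.ofReal_mul (Real.exp_pos _).le, ← Real.exp_add]
        congr 3
        ring

end Spectrum

namespace AuxProcess

variable {𝒜 Se S Sd 𝒳 𝒴 𝒵 Sh : Type*} [MeasurableSpace 𝒜] [MeasurableSpace Se]
  [MeasurableSpace S] [MeasurableSpace Sd] [MeasurableSpace 𝒳] [MeasurableSpace 𝒴]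
  [MeasurableSpace 𝒵] [MeasurableSpace Sh] {M : Model 𝒜 Se S Sd 𝒳 𝒴 𝒵 Sh}
  {𝒰 : Type*} [MeasurableSpace 𝒰] (p : AuxProcess M 𝒰)

instance isProbabilityMeasure_jointLaw (n : ℕ) : IsProbabilityMeasure (p.jointLaw n) := by
  unfold jointLaw
  infer_instance

lemma infRateAux_le_infRateActAux : p.infRateAux ≤ p.infRateActAux := by
  have hm : ∀ n, Measurable fun ω : (((Seq 𝒜 n × (Seq Se n × Seq S n × Seq Sd n)) × Seq 𝒰 n) ×
      Seq 𝒳 n) × (Seq 𝒴 n × Seq 𝒵 n) =>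
        ((ω.1.1.1.1, ω.1.1.2), (ω.2.1, ω.1.1.1.2.2.2)) := fun n => by fun_prop
  have : ∀ n, IsProbabilityMeasure ((p.jointLaw n).map fun ω =>
      ((ω.1.1.1.1, ω.1.1.2), (ω.2.1, ω.1.1.1.2.2.2))) := fun n =>
    Measure.isProbabilityMeasure_map (hm n).aemeasurable
  have h := spectralInfMutual_map_le (fun n => (p.jointLaw n).map fun ω =>
    ((ω.1.1.1.1, ω.1.1.2), (ω.2.1, ω.1.1.1.2.2.2))) (fun _ => Prod.snd) (fun _ => measurable_snd)
  refine le_trans (le_of_eq ?_) h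
  unfold infRateAux
  congr 1
  ext1 n
  rw [Measure.map_map (measurable_snd.prodMap measurable_id) (hm n)]
  rfl

lemma supRateCond_nonneg : 0 ≤ p.supRateCond := by
  have : ∀ n, IsMarkovKernel ((M.state n).fst) := fun n => inferInstance
  exact pLimsup_logRatio_nonneg _ _

end AuxProcess

/-! ### Rejection sampling from an i.i.d. list -/

section RejectionSampling

variable {B : Type*}

open Classical in
/-- The first entry of the nonempty list `b` that lies in the acceptance set `C`; the last entry if
no entry does. -/
noncomputable def firstHit (C : Set B) : (k : ℕ) → (Fin (k + 1) → B) → B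
  | 0, b => b 0
  | k + 1, b => if b 0 ∈ C then b 0 else firstHit C k fun j => b j.succ

lemma exists_firstHit_eq (C : Set B) (k : ℕ) (b : Fin (k + 1) → B) :
    ∃ l, firstHit C k b = b l := by
  induction k with
  | zero => exact ⟨0, rfl⟩
  | succ k ih =>
    by_cases h : b 0 ∈ C
    · exact ⟨0, by simp [firstHit, h]⟩
    · obtain ⟨l, hl⟩ := ih fun j => b j.succ
      exact ⟨l.succ, by simp [firstHit, h, hl]⟩

variable [MeasurableSpace B]

lemma measurable_firstHit {X : Type*} [MeasurableSpace X] {C : Set (X × B)} (hC : MeasurableSet C)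
    (k : ℕ) : Measurable fun p : X × (Fin (k + 1) → B) => firstHit {b | (p.1, b) ∈ C} k p.2 := by
  induction k with
  | zero => exact (measurable_pi_apply 0).comp measurable_snd
  | succ k ih =>
    have h0 : Measurable fun p : X × (Fin (k + 1 + 1) → B) => p.2 0 :=
      (measurable_pi_apply 0).comp measurable_snd
    refine Measurable.ite ?_ h0 ?_
    · exact (measurable_fst.prodMk h0) hC
    · exact ih.comp (g := fun p : X × (Fin (k + 1) → B) => firstHit {b | (p.1, b) ∈ C} k p.2)
        (f := fun p : X × (Fin (k + 1 + 1) → B) => (p.1, fun j => p.2 j.succ))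
        (measurable_fst.prodMk (measurable_pi_lambda _ fun j =>
          (measurable_pi_apply _).comp measurable_snd))

/-- Splitting off one coordinate of an i.i.d. family. -/
lemma lintegral_pi_succAbove {n : ℕ} (μ : Measure B) [IsProbabilityMeasure μ] (i : Fin (n + 1))
    {F : B → (Fin n → B) → ℝ≥0∞} (hF : Measurable (Function.uncurry F)) :
    ∫⁻ b, F (b i) (fun j => b (i.succAbove j)) ∂(Measure.pi fun _ : Fin (n + 1) => μ) =
      ∫⁻ x, ∫⁻ y, F x y ∂(Measure.pi fun _ : Fin n => μ) ∂μ := by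
  have h := (measurePreserving_piFinSuccAbove (fun _ : Fin (n + 1) => μ) i).lintegral_comp hF
  rw [lintegral_prod _ hF.aemeasurable] at h
  exact h

/-- The law of the accepted entry of an i.i.d. list dominates the truncated geometric mixture of the
restriction of the common law to the acceptance set. -/
lemma le_lintegral_firstHit (μ : Measure B) [IsProbabilityMeasure μ] {C : Set B}
    (hC : MeasurableSet C) (k : ℕ) {f : B → ℝ≥0∞} (hf : Measurable f) :
    (∑ l ∈ Finset.range (k + 1), μ Cᶜ ^ l) * ∫⁻ b in C, f b ∂μ ≤
      ∫⁻ b, f (firstHit C k b) ∂(Measure.pi fun _ : Fin (k + 1) => μ) := by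
  have hfh : ∀ k, Measurable fun b : Fin (k + 1) → B => firstHit C k b := fun k =>
    (measurable_firstHit (X := Unit) (C := {p | p.2 ∈ C}) (measurable_snd hC) k).comp
      (measurable_const (a := ()).prodMk measurable_id)
  induction k with
  | zero =>
    have h : ∫⁻ b, f (b 0) ∂(Measure.pi fun _ : Fin (0 + 1) => μ) = ∫⁻ x, f x ∂μ :=
      (measurePreserving_eval (fun _ : Fin (0 + 1) => μ) 0).lintegral_comp hf
    simp only [firstHit, h]
    simpa using setLIntegral_le_lintegral C f
  | succ k ih =>
    classical
    have hF : Measurable (Function.uncurry fun (x : B) (y : Fin (k + 1) → B) =>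
        f (if x ∈ C then x else firstHit C k y)) :=
      hf.comp (Measurable.ite (measurable_fst hC) measurable_fst ((hfh k).comp measurable_snd))
    have h := lintegral_pi_succAbove μ (0 : Fin (k + 1 + 1)) hF
    have h1 : ∫⁻ b, f (firstHit C (k + 1) b) ∂(Measure.pi fun _ : Fin (k + 1 + 1) => μ) =
        ∫⁻ x, ∫⁻ y, f (if x ∈ C then x else firstHit C k y)
          ∂(Measure.pi fun _ : Fin (k + 1) => μ) ∂μ := by
      rw [← h]
      refine lintegral_congr fun b => ?_
      simp only [firstHit, Fin.succAbove_zero]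
    rw [h1, ← lintegral_add_compl (fun x => ∫⁻ y, f (if x ∈ C then x else firstHit C k y)
      ∂(Measure.pi fun _ : Fin (k + 1) => μ)) hC]
    have h2 : ∫⁻ x in C, ∫⁻ y, f (if x ∈ C then x else firstHit C k y)
          ∂(Measure.pi fun _ : Fin (k + 1) => μ) ∂μ = ∫⁻ x in C, f x ∂μ := by
      refine setLIntegral_congr_fun hC fun x hx => ?_
      simp [show x ∈ C from hx]
    have h3 : ∫⁻ x in Cᶜ, ∫⁻ y, f (if x ∈ C then x else firstHit C k y)
          ∂(Measure.pi fun _ : Fin (k + 1) => μ) ∂μ =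
        (∫⁻ y, f (firstHit C k y) ∂(Measure.pi fun _ : Fin (k + 1) => μ)) * μ Cᶜ := by
      rw [← setLIntegral_const]
      refine setLIntegral_congr_fun hC.compl fun x hx => ?_
      simp [show x ∉ C from hx]
    rw [h2, h3, Finset.sum_range_succ', add_mul, pow_zero, one_mul, add_comm]
    refine add_le_add le_rfl ?_
    calc (∑ l ∈ Finset.range (k + 1), μ Cᶜ ^ (l + 1)) * ∫⁻ b in C, f b ∂μ
        = (∑ l ∈ Finset.range (k + 1), μ Cᶜ ^ l) * (∫⁻ b in C, f b ∂μ) * μ Cᶜ := by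
          simp_rw [pow_succ, ← Finset.sum_mul]
          ring
      _ ≤ _ := by gcongr

lemma mul_one_sub_pow_le_geom_sum {T x : ℝ} (hT : 1 ≤ T) (hx : 1 - 1 / T ≤ x) (k : ℕ) :
    T * (1 - (1 - 1 / T) ^ k) ≤ ∑ l ∈ Finset.range k, x ^ l := by
  have hT0 : 0 < T := by linarith
  have h0 : 0 ≤ 1 - 1 / T := by
    rw [sub_nonneg, div_le_one hT0]
    exact hT
  have h1 := mul_neg_geom_sum (1 - 1 / T) k
  rw [← h1]
  have : T * ((1 - (1 - 1 / T)) * ∑ i ∈ Finset.range k, (1 - 1 / T) ^ i) =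
      ∑ i ∈ Finset.range k, (1 - 1 / T) ^ i := by
    field_simp
    ring
  rw [this]
  exact Finset.sum_le_sum fun l _ => pow_le_pow_left₀ h0 hx l

/-- Rejection sampling from `k + 1` trials: if the acceptance probability is at most `1 / T`, the
law of the accepted entry dominates `T • μ.restrict C` up to the factor `1 - (1 - 1 / T) ^ (k + 1)`,
the probability that one of `k + 1` trials of success probability `1 / T` succeeds. -/
lemma ofReal_mul_le_lintegral_firstHit (μ : Measure B) [IsProbabilityMeasure μ] {C : Set B}
    (hC : MeasurableSet C) {T : ℝ} (hT : 1 ≤ T) (hμ : ENNReal.ofReal T * μ C ≤ 1) (k : ℕ)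
    {f : B → ℝ≥0∞} (hf : Measurable f) :
    ENNReal.ofReal (1 - (1 - 1 / T) ^ (k + 1)) * (ENNReal.ofReal T * ∫⁻ b in C, f b ∂μ) ≤
      ∫⁻ b, f (firstHit C k b) ∂(Measure.pi fun _ : Fin (k + 1) => μ) := by
  have hT0 : 0 < T := by linarith
  refine le_trans ?_ (le_lintegral_firstHit μ hC k hf)
  rw [← mul_assoc, ← ENNReal.ofReal_mul' hT0.le]
  gcongr
  have hC1 : T * μ.real C ≤ 1 := by
    have := ENNReal.toReal_mono ENNReal.one_ne_top hμ
    rwa [ENNReal.toReal_mul, ENNReal.toReal_ofReal hT0.le, ENNReal.toReal_one] at this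
  have hx : 1 - 1 / T ≤ μ.real Cᶜ := by
    rw [probReal_compl_eq_one_sub hC]
    have : μ.real C ≤ 1 / T := by
      rw [le_div_iff₀ hT0]
      linarith
    linarith
  have h := mul_one_sub_pow_le_geom_sum hT hx (k + 1)
  calc ENNReal.ofReal ((1 - (1 - 1 / T) ^ (k + 1)) * T)
      ≤ ENNReal.ofReal (∑ l ∈ Finset.range (k + 1), μ.real Cᶜ ^ l) := by
        rw [mul_comm]
        exact ENNReal.ofReal_le_ofReal h
    _ = ∑ l ∈ Finset.range (k + 1), μ Cᶜ ^ l := by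
        rw [ENNReal.ofReal_sum_of_nonneg fun _ _ => by positivity]
        refine Finset.sum_congr rfl fun l _ => ?_
        rw [ENNReal.ofReal_pow measureReal_nonneg, ofReal_measureReal]

end RejectionSampling

/-! ### Kernels -/

section Kernels

variable {X B : Type*} [MeasurableSpace X] [MeasurableSpace B]

/-- The kernel drawing `k` independent samples from a Markov kernel. -/
noncomputable def iidKernel (κ : Kernel X B) [IsMarkovKernel κ] (k : ℕ) : Kernel X (Fin k → B) where
  toFun x := Measure.pi fun _ : Fin k => κ x
  measurable' := by
    refine Measurable.measure_of_isPiSystem_of_isProbabilityMeasure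
      generateFrom_pi.symm isPiSystem_pi ?_
    rintro _ ⟨s, hs, rfl⟩
    simp only [Measure.pi_pi]
    exact Finset.measurable_fun_prod _ fun i _ => κ.measurable_coe (hs i trivial)

instance (κ : Kernel X B) [IsMarkovKernel κ] (k : ℕ) : IsMarkovKernel (iidKernel κ k) :=
  ⟨fun x => inferInstanceAs (IsProbabilityMeasure (Measure.pi fun _ : Fin k => κ x))⟩

lemma iidKernel_apply (κ : Kernel X B) [IsMarkovKernel κ] (k : ℕ) (x : X) :
    iidKernel κ k x = Measure.pi fun _ : Fin k => κ x := rfl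

/-- If `m ⊗ κ` and `m ⊗ κ'` agree after reweighting by `g` and `g'`, then on each fixed set the
reweighted kernels agree `m`-almost everywhere. The exceptional set depends on the set `t`, since
the target space need not be countably generated. -/
lemma ae_setLIntegral_eq_of_withDensity_compProd_eq {F U : Type*} [MeasurableSpace F]
    [MeasurableSpace U] (m : Measure F) [IsFiniteMeasure m] (κ κ' : Kernel F U)
    [IsFiniteKernel κ] [IsFiniteKernel κ'] {g g' : F × U → ℝ≥0∞} (hg : Measurable g)
    (hg' : Measurable g') (h : (m ⊗ₘ κ).withDensity g = (m ⊗ₘ κ').withDensity g') {t : Set U}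
    (ht : MeasurableSet t) :
    ∀ᵐ y ∂m, ∫⁻ u in t, g (y, u) ∂(κ y) = ∫⁻ u in t, g' (y, u) ∂(κ' y) := by
  have hm : ∀ (κ : Kernel F U) [IsFiniteKernel κ] {g : F × U → ℝ≥0∞}, Measurable g →
      Measurable fun y => ∫⁻ u in t, g (y, u) ∂(κ y) := by
    intro κ _ g hg
    exact Measurable.setLIntegral_kernel_prod_right (f := fun y u => g (y, u)) hg ht
  refine ae_eq_of_forall_setLIntegral_eq_of_sigmaFinite (hm κ hg) (hm κ' hg') fun G hG _ => ?_
  rw [← Measure.setLIntegral_compProd hg hG ht, ← Measure.setLIntegral_compProd hg' hG ht,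
    ← withDensity_apply _ (hG.prod ht), ← withDensity_apply _ (hG.prod ht), h]

/-- An identity between reweighted joint laws over `η.map π` lifts to one over `η`. No
disintegration of `η` over `π` is needed: on rectangles, both sides integrate functions that agree
almost everywhere. -/
lemma withDensity_compProd_comap_eq {E F U : Type*} [MeasurableSpace E] [MeasurableSpace F]
    [MeasurableSpace U] (η : Measure E) [IsFiniteMeasure η] {π : E → F} (hπ : Measurable π)
    (κ κ' : Kernel F U) [IsFiniteKernel κ] [IsFiniteKernel κ'] {g g' : F × U → ℝ≥0∞}
    (hg : Measurable g) (hg' : Measurable g') (hb : ∀ z, g z ≤ 1)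
    (h : (η.map π ⊗ₘ κ).withDensity g = (η.map π ⊗ₘ κ').withDensity g') :
    (η ⊗ₘ κ.comap π hπ).withDensity (fun z => g (π z.1, z.2)) =
      (η ⊗ₘ κ'.comap π hπ).withDensity fun z => g' (π z.1, z.2) := by
  have hG : Measurable fun z : E × U => g (π z.1, z.2) := by fun_prop
  have hG' : Measurable fun z : E × U => g' (π z.1, z.2) := by fun_prop
  have : IsFiniteMeasure ((η ⊗ₘ κ.comap π hπ).withDensity fun z => g (π z.1, z.2)) := by
    refine isFiniteMeasure_withDensity (ne_top_of_le_ne_top ?_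
      (lintegral_mono fun z => hb (π z.1, z.2)))
    simp
  refine Measure.ext_prod fun {s t} hs ht => ?_
  rw [withDensity_apply _ (hs.prod ht), withDensity_apply _ (hs.prod ht),
    Measure.setLIntegral_compProd hG hs ht, Measure.setLIntegral_compProd hG' hs ht]
  refine setLIntegral_congr_fun_ae hs ?_
  filter_upwards [ae_of_ae_map hπ.aemeasurable
    (ae_setLIntegral_eq_of_withDensity_compProd_eq _ κ κ' hg hg' h ht)] with x hx _
  exact hx

/-- If one joint law is dominated by `T` times another on a set, it has there a density of the form
`T • q` with an acceptance probability `q ≤ 1`. -/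
lemma exists_acceptance {Ω : Type*} [MeasurableSpace Ω] (μ ν : Measure Ω) [IsFiniteMeasure μ]
    [IsFiniteMeasure ν] {T : ℝ} {s : Set Ω}
    (h : μ.restrict s ≤ ENNReal.ofReal T • ν) :
    ∃ q : Ω → ℝ≥0∞, Measurable q ∧ (∀ ω, q ω ≤ 1) ∧
      μ.restrict s = ν.withDensity fun ω => ENNReal.ofReal T * q ω := by
  have : IsFiniteMeasure (ENNReal.ofReal T • ν) := ν.smul_finite ENNReal.ofReal_ne_top
  refine ⟨fun ω => min 1 ((μ.restrict s).rnDeriv (ENNReal.ofReal T • ν) ω), by fun_prop,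
    fun ω => min_le_left _ _, ?_⟩
  have h1 := Measure.withDensity_rnDeriv_eq _ _ h.absolutelyContinuous
  conv_lhs => rw [← h1]
  rw [withDensity_smul_measure, ← withDensity_smul _ (Measure.measurable_rnDeriv _ _)]
  by_cases hT : ENNReal.ofReal T = 0
  · simp [hT]
  refine withDensity_congr_ae ?_
  have hle := Measure.rnDeriv_le_one_of_le h
  rw [Filter.EventuallyLE, Measure.ae_ennreal_smul_measure_iff hT] at hle
  filter_upwards [hle] with ω hω
  rw [Pi.smul_apply, smul_eq_mul, min_eq_right (show _ ≤ (1 : ℝ≥0∞) from hω)]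

end Kernels

/-! ### Covering the state by a random list of auxiliary sequences -/

section Covering

variable {α τ W U : Type*} [MeasurableSpace α] [MeasurableSpace τ] [MeasurableSpace W]
  [MeasurableSpace U]

/-- The entries `(u, v, c)` that are accepted at `x`: the coin `c`, uniform on `[0, 1]`, falls below
the acceptance probability `q (x, u)`. The middle entry is spare randomness. -/
def acceptSet {F : Type*} (q : F × U → ℝ≥0∞) : Set (F × U × I × I) :=
  {p | ENNReal.ofReal p.2.2.2 ≤ q (p.1, p.2.1)}

lemma measurableSet_acceptSet {F : Type*} [MeasurableSpace F] {q : F × U → ℝ≥0∞}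
    (hq : Measurable q) : MeasurableSet (acceptSet q) :=
  measurableSet_le (by fun_prop) (by fun_prop)

lemma volume_coin {x : ℝ≥0∞} (hx : x ≤ 1) :
    (volume : Measure I) {c | ENNReal.ofReal c ≤ x} = x := by
  have hxt : x ≠ ⊤ := ne_top_of_le_ne_top ENNReal.one_ne_top hx
  have h1 : x.toReal ∈ I := ⟨ENNReal.toReal_nonneg, ENNReal.toReal_mono ENNReal.one_ne_top hx⟩
  have h2 : {c : I | ENNReal.ofReal c ≤ x} = Set.Iic ⟨x.toReal, h1⟩ := by
    ext c
    simp only [Set.mem_ofPred_eq, Set.mem_Iic]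
    rw [ENNReal.ofReal_le_iff_le_toReal hxt]
    rfl
  rw [h2, unitInterval.volume_Iic]
  exact ENNReal.ofReal_toReal hxt

/-- Kernel drawing an entry `(u, v, c)` of the list: `u` from `κ`, and `v` and `c` uniformly from
`[0, 1]`, all independent. -/
noncomputable def entryKernel (κ : Kernel α U) : Kernel α (U × I × I) :=
  κ ×ₖ Kernel.const _ ((volume : Measure I).prod (volume : Measure I))

instance (κ : Kernel α U) [IsMarkovKernel κ] : IsMarkovKernel (entryKernel κ) := by
  unfold entryKernel
  infer_instance

lemma setLIntegral_acceptSet {F : Type*} [MeasurableSpace F] {q : F × U → ℝ≥0∞}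
    (hq : Measurable q) (hq1 : ∀ z, q z ≤ 1) (κ : Kernel α U) [IsMarkovKernel κ] (x : F) (a : α)
    {f : U × I → ℝ≥0∞} (hf : Measurable f) :
    ∫⁻ b in {b | (x, b) ∈ acceptSet q}, f (b.1, b.2.1) ∂(entryKernel κ a) =
      ∫⁻ u, q (x, u) * ∫⁻ v, f (u, v) ∂volume ∂(κ a) := by
  have hS : MeasurableSet {b : U × I × I | (x, b) ∈ acceptSet q} :=
    measurable_prodMk_left (measurableSet_acceptSet hq)
  have hF : Measurable ({b : U × I × I | (x, b) ∈ acceptSet q}.indicator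
      fun b => f (b.1, b.2.1)) := (by fun_prop : Measurable fun b : U × I × I =>
        f (b.1, b.2.1)).indicator hS
  rw [← lintegral_indicator hS, entryKernel, Kernel.prod_apply, Kernel.const_apply,
    lintegral_prod _ hF.aemeasurable]
  refine lintegral_congr fun u => ?_
  rw [lintegral_prod _ (by fun_prop)]
  rw [← lintegral_const_mul _ (by fun_prop)]
  refine lintegral_congr fun v => ?_
  have hc : MeasurableSet {c : I | ENNReal.ofReal c ≤ q (x, u)} :=
    measurableSet_le (by fun_prop) measurable_const
  calc ∫⁻ c, {b : U × I × I | (x, b) ∈ acceptSet q}.indicator (fun b => f (b.1, b.2.1)) (u, v, c)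
      = ∫⁻ c, {c : I | ENNReal.ofReal c ≤ q (x, u)}.indicator (fun _ => f (u, v)) c := by
        refine lintegral_congr fun c => ?_
        by_cases h : ENNReal.ofReal c ≤ q (x, u) <;> simp [Set.indicator, acceptSet, h]
    _ = q (x, u) * f (u, v) := by
        rw [lintegral_indicator hc, setLIntegral_const, volume_coin (hq1 _), mul_comm]

/-- **Covering lemma.** Let `P` be the law of the action and `K` the kernel of the states, only the
component `π` of which is seen by the encoder. If on `s` the joint law with `U ∼ κ` is
dominated by `T` times the joint law with `U ∼ κ'` drawn without knowledge of the state, then the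
encoder, choosing from `k + 1` samples of `κ'` by rejection sampling, produces a joint law that
dominates the true one on `s` up to the factor `1 - (1 - 1 / T) ^ (k + 1)`. -/
lemma exists_covering (P : Measure α) [IsProbabilityMeasure P] (K : Kernel α W)
    [IsMarkovKernel K] {π : W → τ} (hπ : Measurable π) (κ : Kernel (α × τ) U) [IsMarkovKernel κ]
    (κ' : Kernel α U) [IsMarkovKernel κ'] {T : ℝ} (hT : 1 ≤ T) {s : Set ((α × τ) × U)}
    (hs : MeasurableSet s)
    (h : ((P ⊗ₘ K.map π) ⊗ₘ κ).restrict s ≤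
      ENNReal.ofReal T • ((P ⊗ₘ K.map π) ⊗ₘ κ'.comap Prod.fst measurable_fst)) (k : ℕ) :
    ∃ q : (α × τ) × U → ℝ≥0∞, Measurable q ∧
      ∀ f : ((α × W) × U) × I → ℝ≥0∞, Measurable f →
        ENNReal.ofReal (1 - (1 - 1 / T) ^ (k + 1)) *
          ∫⁻ z in {z : (α × W) × U | ((z.1.1, π z.1.2), z.2) ∈ s}, ∫⁻ v, f (z, v) ∂volume
            ∂((P ⊗ₘ K) ⊗ₘ κ.comap (fun x : α × W => (x.1, π x.2)) (by fun_prop)) ≤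
        ∫⁻ x, ∫⁻ b, f ((x, (firstHit {b | ((x.1, π x.2), b) ∈ acceptSet q} k b).1),
            (firstHit {b | ((x.1, π x.2), b) ∈ acceptSet q} k b).2.1)
          ∂(iidKernel (entryKernel κ') (k + 1) x.1) ∂(P ⊗ₘ K) := by
  have : IsMarkovKernel (K.map π) := Kernel.IsMarkovKernel.map K hπ
  obtain ⟨q, hq, hq1, hqd⟩ := exists_acceptance _ _ h
  refine ⟨q, hq, fun f hf => ?_⟩
  have hpr : Measurable fun x : α × W => (x.1, π x.2) := by fun_prop
  have hmap : (P ⊗ₘ K).map (fun x : α × W => (x.1, π x.2)) = P ⊗ₘ K.map π :=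
    (Measure.compProd_map hπ).symm
  rw [← withDensity_indicator_one hs, ← hmap] at hqd
  have hTq : Measurable fun z => ENNReal.ofReal T * q z := by fun_prop
  have hind : Measurable (s.indicator (1 : (α × τ) × U → ℝ≥0∞)) := measurable_one.indicator hs
  have hind1 : ∀ z, s.indicator (1 : (α × τ) × U → ℝ≥0∞) z ≤ 1 := fun z =>
    Set.indicator_le_self' (by simp) z
  have hlift := withDensity_compProd_comap_eq (P ⊗ₘ K) hpr κ (κ'.comap Prod.fst measurable_fst)
    hind hTq hind1 hqd
  have hae := ae_of_ae_map hpr.aemeasurable (ae_setLIntegral_eq_of_withDensity_compProd_eq _ κ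
    (κ'.comap Prod.fst measurable_fst) hind hTq hqd MeasurableSet.univ)
  set s' := {z : (α × W) × U | ((z.1.1, π z.1.2), z.2) ∈ s}
  have hs' : MeasurableSet s' :=
    (by fun_prop : Measurable fun z : (α × W) × U => ((z.1.1, π z.1.2), z.2)) hs
  have hfv : Measurable fun z : (α × W) × U => ∫⁻ v, f (z, v) ∂volume := by fun_prop
  have hleft : ∫⁻ z in s', ∫⁻ v, f (z, v) ∂volume
      ∂((P ⊗ₘ K) ⊗ₘ κ.comap (fun x : α × W => (x.1, π x.2)) hpr) =
      ∫⁻ x, ENNReal.ofReal T * ∫⁻ u, q ((x.1, π x.2), u) * ∫⁻ v, f ((x, u), v) ∂volume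
        ∂(κ' x.1) ∂(P ⊗ₘ K) := by
    have hr : ((P ⊗ₘ K) ⊗ₘ κ.comap (fun x : α × W => (x.1, π x.2)) hpr).restrict s' =
        ((P ⊗ₘ K) ⊗ₘ κ.comap (fun x : α × W => (x.1, π x.2)) hpr).withDensity
          fun z => s.indicator 1 ((z.1.1, π z.1.2), z.2) := by
      rw [← withDensity_indicator_one hs']
      rfl
    rw [hr, hlift, lintegral_withDensity_eq_lintegral_mul _ (by fun_prop) hfv,
      Measure.lintegral_compProd (by fun_prop)]
    refine lintegral_congr fun x => ?_
    rw [← lintegral_const_mul _ (by fun_prop)]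
    refine lintegral_congr fun u => ?_
    simp only [Pi.mul_apply]
    rw [mul_assoc]
  have hm : Measurable fun x : α × W => ∫⁻ u, q ((x.1, π x.2), u) * ∫⁻ v, f ((x, u), v) ∂volume
      ∂(κ' x.1) :=
    Measurable.lintegral_kernel_prod_right' (κ := κ'.comap Prod.fst measurable_fst)
      (f := fun p : (α × W) × U => q ((p.1.1, π p.1.2), p.2) * ∫⁻ v, f (p, v) ∂volume)
      (by fun_prop)
  rw [hleft, ← lintegral_const_mul _ (hm.const_mul _)]
  refine lintegral_mono_ae ?_
  filter_upwards [hae] with x hx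
  have hS : MeasurableSet {b : U × I × I | ((x.1, π x.2), b) ∈ acceptSet q} :=
    measurable_prodMk_left (measurableSet_acceptSet hq)
  have hfx : Measurable fun p : U × I => f ((x, p.1), p.2) := by fun_prop
  have hacc := setLIntegral_acceptSet hq hq1 κ' (x.1, π x.2) x.1 hfx
  have hone := setLIntegral_acceptSet hq hq1 κ' (x.1, π x.2) x.1
    (f := fun _ => 1) measurable_const
  simp only [lintegral_const, measure_univ, mul_one, Measure.restrict_apply, MeasurableSet.univ,
    Set.univ_inter, one_mul] at hone
  have hle : ENNReal.ofReal T *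
      entryKernel κ' x.1 {b : U × I × I | ((x.1, π x.2), b) ∈ acceptSet q} ≤ 1 := by
    rw [hone, ← lintegral_const_mul _ (by fun_prop)]
    simp only [Measure.restrict_univ, Kernel.comap_apply] at hx
    rw [← hx]
    calc ∫⁻ u, s.indicator 1 ((x.1, π x.2), u) ∂(κ (x.1, π x.2))
        ≤ ∫⁻ _, 1 ∂(κ (x.1, π x.2)) := lintegral_mono fun u => hind1 _
      _ = 1 := by simp
  rw [← hacc]
  exact ofReal_mul_le_lintegral_firstHit (entryKernel κ' x.1) hS hT hle k
    (f := fun b => f ((x, b.1), b.2.1)) (by fun_prop)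

end Covering

/-! ### Random coding for an abstract channel -/

section RandomCoding

/-- A probability measure `ν` that dominates `c • μ.restrict s` is close to `μ` in total variation;
this is the form of closeness used for events and bounded costs. -/
lemma lintegral_le_of_smul_restrict_le {Ω : Type*} [MeasurableSpace Ω] {μ ν : Measure Ω}
    [IsProbabilityMeasure μ] [IsProbabilityMeasure ν] {r : ℝ} (hr0 : 0 ≤ r) (hr1 : r ≤ 1)
    {s : Set Ω} (hs : MeasurableSet s) (h : ENNReal.ofReal (1 - r) • μ.restrict s ≤ ν)
    {f : Ω → ℝ≥0∞} {b : ℝ≥0∞} (hf : ∀ ω, f ω ≤ b) :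
    ∫⁻ ω, f ω ∂ν ≤ ∫⁻ ω, f ω ∂μ + b * (ENNReal.ofReal r + μ sᶜ) := by
  set ρ := ENNReal.ofReal (1 - r) • μ.restrict s
  have : IsFiniteMeasure ρ := (μ.restrict s).smul_finite ENNReal.ofReal_ne_top
  have hν : ν = (ν - ρ) + ρ := (Measure.sub_add_cancel_of_le h).symm
  have hρ : ρ ≤ μ := by
    calc ρ ≤ (1 : ℝ≥0∞) • μ.restrict s := by
          refine Measure.le_iff.2 fun t _ => ?_
          simp only [ρ, Measure.smul_apply, smul_eq_mul, one_smul]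
          exact mul_le_of_le_one_left' (by simpa using hr0)
      _ ≤ μ := by rw [one_smul]; exact Measure.restrict_le_self
  have hmass : (ν - ρ) Set.univ ≤ ENNReal.ofReal r + μ sᶜ := by
    rw [Measure.sub_apply MeasurableSet.univ h, measure_univ]
    simp only [ρ, Measure.smul_apply, smul_eq_mul, Measure.restrict_apply MeasurableSet.univ,
      Set.univ_inter]
    rw [tsub_le_iff_right]
    calc (1 : ℝ≥0∞) = ENNReal.ofReal r + ENNReal.ofReal (1 - r) * (μ sᶜ + μ s) := by
          rw [add_comm (μ sᶜ), measure_add_measure_compl hs, measure_univ, mul_one,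
            ← ENNReal.ofReal_add hr0 (by linarith)]
          simp
      _ ≤ ENNReal.ofReal r + (μ sᶜ + ENNReal.ofReal (1 - r) * μ s) := by
          rw [mul_add]
          gcongr
          exact mul_le_of_le_one_left' (by simpa using hr0)
      _ = _ := by rw [add_assoc]
  calc ∫⁻ ω, f ω ∂ν = ∫⁻ ω, f ω ∂ρ + ∫⁻ ω, f ω ∂(ν - ρ) := by
        conv_lhs => rw [hν, lintegral_add_measure, add_comm]
    _ ≤ ∫⁻ ω, f ω ∂μ + ∫⁻ _, b ∂(ν - ρ) :=
        add_le_add (lintegral_mono' hρ le_rfl) (lintegral_mono hf)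
    _ ≤ _ := by
        rw [lintegral_const]
        gcongr

/-- Decoding by uniqueness: the output is decoded to the only index whose test it passes. -/
lemma exists_decoder {O : Type*} [MeasurableSpace O] {N : ℕ} (S : Fin (N + 1) → Set O)
    (hS : ∀ m, MeasurableSet (S m)) :
    ∃ dec : O → Fin (N + 1), Measurable dec ∧
      ∀ o m, o ∈ S m → (∀ m', m' ≠ m → o ∉ S m') → dec o = m := by
  classical
  let D : Fin (N + 1) → Set O := fun m => S m ∩ ⋂ m', ⋂ (_ : m' ≠ m), (S m')ᶜ
  have hD : ∀ m, MeasurableSet (D m) := fun m =>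
    (hS m).inter (MeasurableSet.iInter fun m' => MeasurableSet.iInter fun _ => (hS m').compl)
  have huniq : ∀ o m m', o ∈ D m → o ∈ D m' → m = m' := by
    intro o m m' h h'
    by_contra hne
    exact (Set.mem_iInter₂.1 h'.2 m hne) h.1
  let dec : O → Fin (N + 1) := fun o => if h : ∃ m, o ∈ D m then h.choose else 0
  have hdec : ∀ o m, o ∈ D m → dec o = m := by
    intro o m h
    have hex : ∃ m, o ∈ D m := ⟨m, h⟩
    simp only [dec, dif_pos hex]
    exact huniq o _ _ hex.choose_spec h
  refine ⟨dec, measurable_to_countable' fun m => ?_, fun o m h1 h2 =>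
    hdec o m ⟨h1, Set.mem_iInter₂.2 fun m' hm' => h2 m' hm'⟩⟩
  have : dec ⁻¹' {m} = D m ∪ (if m = 0 then (⋃ m', D m')ᶜ else ∅) := by
    ext o
    by_cases h : ∃ m', o ∈ D m'
    · obtain ⟨m', hm'⟩ := h
      have h1 : dec o = m' := hdec o m' hm'
      have h2 : o ∈ ⋃ m', D m' := Set.mem_iUnion.2 ⟨m', hm'⟩
      constructor
      · intro h3
        have h4 : m' = m := h1 ▸ h3
        exact Or.inl (h4 ▸ hm')
      · rintro (h3 | h3)
        · exact hdec o m h3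
        · split_ifs at h3
          · exact absurd h2 h3
          · exact absurd h3 (Set.notMem_empty _)
    · have h1 : dec o = 0 := dif_neg h
      have h2 : o ∉ ⋃ m', D m' := fun h' => h (Set.mem_iUnion.1 h')
      have h3 : o ∉ D m := fun h' => h ⟨m, h'⟩
      by_cases hm : m = 0
      · rw [if_pos hm]
        exact ⟨fun _ => Or.inr h2, fun _ => h1.trans hm.symm⟩
      · simp [h1, h3, hm, Ne.symm hm]
  rw [this]
  refine (hD m).union ?_
  split_ifs
  · exact (MeasurableSet.iUnion hD).compl
  · exact MeasurableSet.empty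

variable {Ω O : Type*} [MeasurableSpace Ω] [MeasurableSpace O]

/-- **Random coding bound.** The codewords are i.i.d. with law `G`, and `V` is the channel from
codewords to outputs. The output law induced by a random codeword is within `δ` of the reference law
`ρ`. Then some codebook with `N + 1` codewords has average cost (a weighted error probability plus
`cost`) no larger than the union bound over the `N` wrong codewords predicts. -/
lemma exists_codebook (G : Measure Ω) [IsProbabilityMeasure G] (V : Kernel Ω O) [IsMarkovKernel V]
    {S : Set (Ω × O)} (hS : MeasurableSet S) (ρ : Measure O) [IsProbabilityMeasure ρ] (δ : ℝ≥0∞)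
    (hρ : ∀ E, MeasurableSet E → ∫⁻ x, V x E ∂G ≤ ρ E + δ) {cost : Ω → ℝ≥0∞}
    (hcost : Measurable cost) (a : ℝ≥0∞) (N : ℕ) :
    ∃ (cw : Fin (N + 1) → Ω) (dec : O → Fin (N + 1)), Measurable dec ∧
      ∑ m, (a * V (cw m) {o | dec o ≠ m} + cost (cw m)) ≤
        (N + 1) * (a * ((G ⊗ₘ V) Sᶜ + δ + N * (G.prod ρ) S) + ∫⁻ x, cost x ∂G) := by
  -- The section of `E` at `(x, y)` contains the error event when `x` is sent and `y` lists the
  -- other codewords.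
  let E : Set ((Ω × (Fin N → Ω)) × O) :=
    {p | (p.1.1, p.2) ∉ S} ∪ ⋃ j, {p | (p.1.2 j, p.2) ∈ S}
  have hE1 : MeasurableSet {p : (Ω × (Fin N → Ω)) × O | (p.1.1, p.2) ∉ S} :=
    (by fun_prop : Measurable fun p : (Ω × (Fin N → Ω)) × O => (p.1.1, p.2)) hS.compl
  have hE2 : ∀ j, MeasurableSet {p : (Ω × (Fin N → Ω)) × O | (p.1.2 j, p.2) ∈ S} := fun j =>
    (by fun_prop : Measurable fun p : (Ω × (Fin N → Ω)) × O => (p.1.2 j, p.2)) hS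
  have hE : MeasurableSet E := hE1.union (MeasurableSet.iUnion hE2)
  let F : Ω → (Fin N → Ω) → ℝ≥0∞ := fun x y => a * V x {o | ((x, y), o) ∈ E} + cost x
  have hVm : Measurable fun z : Ω × (Fin N → Ω) => V z.1 {o | (z, o) ∈ E} :=
    Kernel.measurable_kernel_prodMk_left (κ := V.comap Prod.fst measurable_fst) hE
  have hF : Measurable (Function.uncurry F) :=
    (hVm.const_mul a).add (hcost.comp measurable_fst)
  have hFm : ∀ m : Fin (N + 1), Measurable fun cw : Fin (N + 1) → Ω =>
      F (cw m) fun j => cw (m.succAbove j) := fun m =>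
    hF.comp (g := Function.uncurry F) (f := fun cw : Fin (N + 1) → Ω =>
      (cw m, fun j => cw (m.succAbove j))) (by fun_prop)
  have hbound : ∫⁻ x, ∫⁻ y, F x y ∂(Measure.pi fun _ : Fin N => G) ∂G ≤
      a * ((G ⊗ₘ V) Sᶜ + δ + N * (G.prod ρ) S) + ∫⁻ x, cost x ∂G := by
    have hsplit : ∫⁻ x, ∫⁻ y, F x y ∂(Measure.pi fun _ : Fin N => G) ∂G =
        a * ∫⁻ y, ∫⁻ x, V x {o | ((x, y), o) ∈ E} ∂G ∂(Measure.pi fun _ : Fin N => G) +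
          ∫⁻ x, cost x ∂G := by
      have h1 : ∀ x, ∫⁻ y, F x y ∂(Measure.pi fun _ : Fin N => G) =
          a * ∫⁻ y, V x {o | ((x, y), o) ∈ E} ∂(Measure.pi fun _ : Fin N => G) + cost x := by
        intro x
        have : Measurable fun y : Fin N → Ω => V x {o | ((x, y), o) ∈ E} :=
          hVm.comp measurable_prodMk_left
        simp only [F]
        rw [lintegral_add_right _ measurable_const, lintegral_const_mul _ this]
        simp
      simp_rw [h1]
      rw [lintegral_add_right _ hcost, lintegral_const_mul _ hVm.lintegral_prod_right',
        lintegral_lintegral_swap hVm.aemeasurable]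
    rw [hsplit]
    gcongr
    calc ∫⁻ y, ∫⁻ x, V x {o | ((x, y), o) ∈ E} ∂G ∂(Measure.pi fun _ : Fin N => G)
        ≤ ∫⁻ y, ((G ⊗ₘ V) Sᶜ + (∑ j : Fin N, ρ {o | (y j, o) ∈ S} + δ))
            ∂(Measure.pi fun _ : Fin N => G) := by
          refine lintegral_mono fun y => ?_
          have hU : MeasurableSet (⋃ j, {o : O | (y j, o) ∈ S}) :=
            MeasurableSet.iUnion fun j => measurable_prodMk_left hS
          have hVS : Measurable fun x => V x {o | (x, o) ∉ S} :=
            Kernel.measurable_kernel_prodMk_left hS.compl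
          calc ∫⁻ x, V x {o | ((x, y), o) ∈ E} ∂G
              ≤ ∫⁻ x, (V x {o | (x, o) ∉ S} + V x (⋃ j, {o | (y j, o) ∈ S})) ∂G := by
                refine lintegral_mono fun x => (measure_mono ?_).trans (measure_union_le _ _)
                rintro o (h | h)
                · exact Or.inl h
                · obtain ⟨j, hj⟩ := Set.mem_iUnion.1 h
                  exact Or.inr (Set.mem_iUnion.2 ⟨j, hj⟩)
            _ = (G ⊗ₘ V) Sᶜ + ∫⁻ x, V x (⋃ j, {o | (y j, o) ∈ S}) ∂G := by
                rw [lintegral_add_left hVS, Measure.compProd_apply hS.compl]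
                rfl
            _ ≤ _ := by
                gcongr
                refine (hρ _ hU).trans ?_
                gcongr
                exact measure_iUnion_fintype_le _ _
      _ = (G ⊗ₘ V) Sᶜ + (∑ j : Fin N, ∫⁻ y, ρ {o | (y j, o) ∈ S}
            ∂(Measure.pi fun _ : Fin N => G) + δ) := by
          have hm : Measurable fun x => ρ {o | (x, o) ∈ S} := measurable_measure_prodMk_left hS
          have hmj : ∀ j : Fin N, Measurable fun y : Fin N → Ω => ρ {o | (y j, o) ∈ S} := fun j =>
            hm.comp (measurable_pi_apply j)
          rw [lintegral_add_left measurable_const, lintegral_add_right _ measurable_const,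
            lintegral_finsetSum _ fun j _ => hmj j]
          simp
      _ = (G ⊗ₘ V) Sᶜ + δ + N * (G.prod ρ) S := by
          have hm : Measurable fun x => ρ {o | (x, o) ∈ S} := measurable_measure_prodMk_left hS
          have hj : ∀ j : Fin N, ∫⁻ y, ρ {o | (y j, o) ∈ S} ∂(Measure.pi fun _ : Fin N => G) =
              (G.prod ρ) S := by
            intro j
            rw [Measure.prod_apply hS]
            exact (measurePreserving_eval (fun _ : Fin N => G) j).lintegral_comp hm
          simp only [hj, Finset.sum_const, Finset.card_univ, Fintype.card_fin, nsmul_eq_mul]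
          ring
  obtain ⟨cw, hcw⟩ := exists_le_lintegral
    (μ := Measure.pi fun _ : Fin (N + 1) => G)
    (f := fun cw => ∑ m, F (cw m) fun j => cw (m.succAbove j))
    (Finset.measurable_fun_sum _ fun m _ => hFm m).aemeasurable
  obtain ⟨dec, hdec, hdec'⟩ := exists_decoder (fun m => {o | (cw m, o) ∈ S})
    fun m => measurable_prodMk_left hS
  refine ⟨cw, dec, hdec, ?_⟩
  calc ∑ m, (a * V (cw m) {o | dec o ≠ m} + cost (cw m))
      ≤ ∑ m, F (cw m) fun j => cw (m.succAbove j) := by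
        refine Finset.sum_le_sum fun m _ => ?_
        simp only [F]
        gcongr with o
        intro ho
        by_contra hcon
        have hcon' : ¬ ((cw m, o) ∉ S ∨ ∃ j, (cw (m.succAbove j), o) ∈ S) := fun h =>
          hcon (h.imp id fun ⟨j, hj⟩ => Set.mem_iUnion.2 ⟨j, hj⟩)
        push Not at hcon'
        refine ho (hdec' o m hcon'.1 fun m' hm' => ?_)
        obtain ⟨j, rfl⟩ := Fin.exists_succAbove_eq hm'
        exact hcon'.2 j
    _ ≤ _ := hcw
    _ = ∑ m : Fin (N + 1), ∫⁻ x, ∫⁻ y, F x y ∂(Measure.pi fun _ : Fin N => G) ∂G := by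
        rw [lintegral_finsetSum _ fun m _ => hFm m]
        exact Finset.sum_congr rfl fun m _ => lintegral_pi_succAbove G m hF
    _ ≤ ∑ m : Fin (N + 1),
          (a * ((G ⊗ₘ V) Sᶜ + δ + N * (G.prod ρ) S) + ∫⁻ x, cost x ∂G) :=
        Finset.sum_le_sum fun _ _ => hbound
    _ = _ := by
        rw [Finset.sum_const, Finset.card_univ, Fintype.card_fin, nsmul_eq_mul]
        push_cast
        rfl

lemma ofReal_average {N : ℕ} (hN : 0 < N) {f : Fin N → ℝ} (hf : ∀ m, 0 ≤ f m) :
    ENNReal.ofReal (1 / (N : ℝ) * ∑ m, f m) =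
      (N : ℝ≥0∞)⁻¹ * ∑ m, ENNReal.ofReal (f m) := by
  rw [ENNReal.ofReal_mul (by positivity), ENNReal.ofReal_sum_of_nonneg fun m _ => hf m, one_div,
    ENNReal.ofReal_inv_of_pos (by positivity), ENNReal.ofReal_natCast]

end RandomCoding

variable {𝒜 Se S Sd 𝒳 𝒴 𝒵 Sh : Type*} [MeasurableSpace 𝒜] [MeasurableSpace Se]
  [MeasurableSpace S] [MeasurableSpace Sd] [MeasurableSpace 𝒳] [MeasurableSpace 𝒴]
  [MeasurableSpace 𝒵] [MeasurableSpace Sh]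

/-! ### The random code ensemble of a process -/

/-- The law of `((S_e^n, S^n, S_d^n), (Y^n, Z^n))` as a function of a codeword `x`, which determines
the action sequence `act x` and the encoding map `enc x`. -/
noncomputable def Model.outKernel (M : Model 𝒜 Se S Sd 𝒳 𝒴 𝒵 Sh) (n : ℕ) {C : Type*}
    [MeasurableSpace C] {act : C → Seq 𝒜 n} (hact : Measurable act) {enc : C → Seq Se n → Seq 𝒳 n}
    (henc : Measurable (Function.uncurry enc)) :
    Kernel C ((Seq Se n × Seq S n × Seq Sd n) × (Seq 𝒴 n × Seq 𝒵 n)) :=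
  (M.state n).comap act hact ⊗ₖ
    (M.channel n).comap (fun x : C × (Seq Se n × Seq S n × Seq Sd n) => (enc x.1 x.2.1, x.2.2.1))
      (by
        have : Measurable fun x : C × (Seq Se n × Seq S n × Seq Sd n) => enc x.1 x.2.1 :=
          henc.comp (g := Function.uncurry enc)
            (f := fun x : C × (Seq Se n × Seq S n × Seq Sd n) => (x.1, x.2.1)) (by fun_prop)
        fun_prop)

section OutKernel

variable (M : Model 𝒜 Se S Sd 𝒳 𝒴 𝒵 Sh) (n : ℕ) {C : Type*}
    [MeasurableSpace C] {act : C → Seq 𝒜 n} (hact : Measurable act) {enc : C → Seq Se n → Seq 𝒳 n}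
    (henc : Measurable (Function.uncurry enc))

instance : IsMarkovKernel (M.outKernel n hact henc) := by
  unfold Model.outKernel
  infer_instance

lemma outKernel_apply (x : C) :
    M.outKernel n hact henc x = M.state n (act x) ⊗ₘ
      (M.channel n).comap (fun w : Seq Se n × Seq S n × Seq Sd n => (enc x w.1, w.2.1))
        (by have : Measurable (enc x) := henc.of_uncurry_left; fun_prop) := by
  rw [Model.outKernel, Kernel.compProd_apply_eq_compProd_sectR]
  rfl

instance (c : Code M n) (m : Fin c.size) : IsProbabilityMeasure (c.outLaw m) := by
  unfold Code.outLaw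
  infer_instance

end OutKernel

namespace AuxProcess

variable {M : Model 𝒜 Se S Sd 𝒳 𝒴 𝒵 Sh} {𝒰 : Type*} [MeasurableSpace 𝒰] (p : AuxProcess M 𝒰)

/-- The law of `U^n` given `A^n`. -/
noncomputable def auxGivenAct (n : ℕ) : Kernel (Seq 𝒜 n) (Seq 𝒰 n) :=
  ((M.state n).fst ⊗ₖ p.aux n).snd

instance (n : ℕ) : IsMarkovKernel (p.auxGivenAct n) := by
  unfold auxGivenAct
  infer_instance

/-- The law of `((A^n, U^n), (Y^n, S_d^n))`. -/
noncomputable def decLaw (n : ℕ) : Measure ((Seq 𝒜 n × Seq 𝒰 n) × (Seq 𝒴 n × Seq Sd n)) :=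
  (p.jointLaw n).map fun ω => ((ω.1.1.1.1, ω.1.1.2), (ω.2.1, ω.1.1.1.2.2.2))

instance (n : ℕ) : IsProbabilityMeasure (p.decLaw n) :=
  Measure.isProbabilityMeasure_map (by fun_prop)

/-- The law of a random codeword: an action sequence together with `k + 1` list entries, which given
the action sequence are independent copies of `U^n`, each with two uniform variables. -/
noncomputable def codewordLaw (n k : ℕ) :
    Measure (Seq 𝒜 n × (Fin (k + 1) → Seq 𝒰 n × I × I)) :=
  p.act n ⊗ₘ iidKernel (entryKernel (p.auxGivenAct n)) (k + 1)

instance (n k : ℕ) : IsProbabilityMeasure (p.codewordLaw n k) := by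
  unfold codewordLaw
  infer_instance

/-- The encoder side of the random code: for a random codeword there are an encoding map `enc` and a
selection `sel` of a list entry such that the induced law of all variables dominates the
law of the process on `s`, up to a factor close to `1`. -/
lemma exists_ensemble [StandardBorelSpace 𝒳] (n k : ℕ) {T : ℝ} (hT : 1 ≤ T)
    {s : Set ((Seq 𝒜 n × Seq Se n) × Seq 𝒰 n)} (hs : MeasurableSet s)
    (h : ((p.act n ⊗ₘ (M.state n).fst) ⊗ₘ p.aux n).restrict s ≤
      ENNReal.ofReal T •
        ((p.act n ⊗ₘ (M.state n).fst) ⊗ₘ (p.auxGivenAct n).comap Prod.fst measurable_fst)) :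
    ∃ (sel : (Seq 𝒜 n × (Fin (k + 1) → Seq 𝒰 n × I × I)) → Seq Se n → Seq 𝒰 n)
      (enc : (Seq 𝒜 n × (Fin (k + 1) → Seq 𝒰 n × I × I)) → Seq Se n → Seq 𝒳 n)
      (_ : Measurable (Function.uncurry sel)) (henc : Measurable (Function.uncurry enc)),
      (∀ x w, ∃ l, sel x w = (x.2 l).1) ∧
      ENNReal.ofReal (1 - (1 - 1 / T) ^ (k + 1)) •
          (p.jointLaw n).restrict {ω | ((ω.1.1.1.1, ω.1.1.1.2.1), ω.1.1.2) ∈ s} ≤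
        (p.codewordLaw n k ⊗ₘ M.outKernel n measurable_fst henc).map
          fun z => ((((z.1.1, z.2.1), sel z.1 z.2.1.1), enc z.1 z.2.1.1), z.2.2) := by
  have hne : Nonempty (Seq 𝒳 n) :=
    (nonempty_of_isProbabilityMeasure (p.jointLaw n)).map fun ω => ω.1.2
  obtain ⟨φ, hφ, hφ'⟩ := Kernel.exists_measurable_map_eq_unitInterval (p.inp n)
  rw [Kernel.fst_eq] at h
  obtain ⟨q, hq, hcov⟩ := exists_covering (p.act n) (M.state n)
    (measurable_fst : Measurable (Prod.fst : Seq Se n × Seq S n × Seq Sd n → Seq Se n)) (p.aux n)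
    (p.auxGivenAct n) hT hs h k
  let hit : (Seq 𝒜 n × (Fin (k + 1) → Seq 𝒰 n × I × I)) → Seq Se n → Seq 𝒰 n × I × I :=
    fun x w => firstHit {b | ((x.1, w), b) ∈ acceptSet q} k x.2
  have hhit : Measurable (Function.uncurry hit) :=
    (measurable_firstHit (measurableSet_acceptSet hq) k).comp
      (g := fun r : (Seq 𝒜 n × Seq Se n) × (Fin (k + 1) → Seq 𝒰 n × I × I) =>
        firstHit {b | (r.1, b) ∈ acceptSet q} k r.2)
      (f := fun r : (Seq 𝒜 n × (Fin (k + 1) → Seq 𝒰 n × I × I)) × Seq Se n =>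
        ((r.1.1, r.2), r.1.2)) (by fun_prop)
  have hsel : Measurable (Function.uncurry fun x w => (hit x w).1) := hhit.fst
  have henc : Measurable (Function.uncurry fun x w => φ ((hit x w).1, w) (hit x w).2.1) :=
    hφ.comp (g := Function.uncurry φ)
      (f := fun r : (Seq 𝒜 n × (Fin (k + 1) → Seq 𝒰 n × I × I)) × Seq Se n =>
        (((Function.uncurry hit r).1, r.2), (Function.uncurry hit r).2.1)) (by fun_prop)
  refine ⟨fun x w => (hit x w).1, fun x w => φ ((hit x w).1, w) (hit x w).2.1, hsel, henc,
    fun x w => ?_, ?_⟩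
  · obtain ⟨l, hl⟩ := exists_firstHit_eq {b | ((x.1, w), b) ∈ acceptSet q} k x.2
    exact ⟨l, congrArg Prod.fst hl⟩
  refine Measure.le_iff.2 fun E hE => ?_
  set s' := {ω : (((Seq 𝒜 n × (Seq Se n × Seq S n × Seq Sd n)) × Seq 𝒰 n) × Seq 𝒳 n) ×
      (Seq 𝒴 n × Seq 𝒵 n) | ((ω.1.1.1.1, ω.1.1.1.2.1), ω.1.1.2) ∈ s}
  have hs' : MeasurableSet s' := by
    refine (?_ : Measurable fun ω : (((Seq 𝒜 n × (Seq Se n × Seq S n × Seq Sd n)) × Seq 𝒰 n) ×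
      Seq 𝒳 n) × (Seq 𝒴 n × Seq 𝒵 n) => ((ω.1.1.1.1, ω.1.1.1.2.1), ω.1.1.2)) hs
    fun_prop
  -- The conditional probability of `E` given the states, the auxiliary sequence and the spare
  -- uniform variable from which the channel input is generated.
  let f : ((Seq 𝒜 n × (Seq Se n × Seq S n × Seq Sd n)) × Seq 𝒰 n) × I → ℝ≥0∞ := fun r =>
    M.channel n (φ (r.1.2, r.1.1.2.1) r.2, r.1.1.2.2.1)
      {yz | ((r.1, φ (r.1.2, r.1.1.2.1) r.2), yz) ∈ E}
  have hφr : Measurable fun r : ((Seq 𝒜 n × (Seq Se n × Seq S n × Seq Sd n)) × Seq 𝒰 n) × I =>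
      φ (r.1.2, r.1.1.2.1) r.2 :=
    hφ.comp (g := Function.uncurry φ)
      (f := fun r : ((Seq 𝒜 n × (Seq Se n × Seq S n × Seq Sd n)) × Seq 𝒰 n) × I =>
        ((r.1.2, r.1.1.2.1), r.2)) (by fun_prop)
  have hf : Measurable f :=
    Kernel.measurable_kernel_prodMk_left
      (κ := (M.channel n).comap
        (fun r : ((Seq 𝒜 n × (Seq Se n × Seq S n × Seq Sd n)) × Seq 𝒰 n) × I =>
          (φ (r.1.2, r.1.1.2.1) r.2, r.1.1.2.2.1)) (by fun_prop))
      ((by fun_prop : Measurable fun r :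
        (((Seq 𝒜 n × (Seq Se n × Seq S n × Seq Sd n)) × Seq 𝒰 n) × I) × (Seq 𝒴 n × Seq 𝒵 n) =>
          ((r.1.1, φ (r.1.1.2, r.1.1.1.2.1) r.1.2), r.2)) hE)
  have hleft : (p.jointLaw n).restrict s' E =
      ∫⁻ z in {z : (Seq 𝒜 n × (Seq Se n × Seq S n × Seq Sd n)) × Seq 𝒰 n |
        ((z.1.1, z.1.2.1), z.2) ∈ s}, ∫⁻ v, f (z, v) ∂volume
          ∂((p.act n ⊗ₘ M.state n) ⊗ₘ (p.aux n).comap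
            (fun x : Seq 𝒜 n × (Seq Se n × Seq S n × Seq Sd n) => (x.1, x.2.1)) (by fun_prop)) := by
    have hs'' : MeasurableSet {z : (Seq 𝒜 n × (Seq Se n × Seq S n × Seq Sd n)) × Seq 𝒰 n |
        ((z.1.1, z.1.2.1), z.2) ∈ s} :=
      (by fun_prop : Measurable fun z : (Seq 𝒜 n × (Seq Se n × Seq S n × Seq Sd n)) × Seq 𝒰 n =>
        ((z.1.1, z.1.2.1), z.2)) hs
    rw [Measure.restrict_apply hE, jointLaw, Measure.compProd_apply (hE.inter hs'),
      Measure.lintegral_compProd (Kernel.measurable_kernel_prodMk_left (hE.inter hs')),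
      ← lintegral_indicator hs'']
    refine lintegral_congr fun z => ?_
    by_cases hz : ((z.1.1, z.1.2.1), z.2) ∈ s
    · rw [Set.indicator_of_mem (s := {z : (Seq 𝒜 n × (Seq Se n × Seq S n × Seq Sd n)) × Seq 𝒰 n |
        ((z.1.1, z.1.2.1), z.2) ∈ s}) hz, Kernel.comap_apply, ← hφ']
      have hmz := (Kernel.measurable_kernel_prodMk_left (κ := (M.channel n).comap
        (fun ω : ((Seq 𝒜 n × (Seq Se n × Seq S n × Seq Sd n)) × Seq 𝒰 n) × Seq 𝒳 n =>
          (ω.2, ω.1.1.2.2.1)) (by fun_prop)) (hE.inter hs')).comp (measurable_prodMk_left (x := z))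
      refine (lintegral_map hmz hφ.of_uncurry_left).trans ?_
      refine lintegral_congr fun v => ?_
      simp only [f, Function.comp_apply, Kernel.comap_apply]
      congr 1
      ext yz
      simp [s', hz]
    · rw [Set.indicator_of_notMem (s := {z : (Seq 𝒜 n × (Seq Se n × Seq S n × Seq Sd n)) × Seq 𝒰 n |
        ((z.1.1, z.1.2.1), z.2) ∈ s}) hz]
      simp [s', hz]
  have hright : ((p.codewordLaw n k ⊗ₘ M.outKernel n measurable_fst henc).map
      fun z => ((((z.1.1, z.2.1), (hit z.1 z.2.1.1).1),
        φ ((hit z.1 z.2.1.1).1, z.2.1.1) (hit z.1 z.2.1.1).2.1), z.2.2)) E =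
      ∫⁻ x, ∫⁻ b, f ((x, (hit (x.1, b) x.2.1).1), (hit (x.1, b) x.2.1).2.1)
        ∂(iidKernel (entryKernel (p.auxGivenAct n)) (k + 1) x.1) ∂(p.act n ⊗ₘ M.state n) := by
    have hΨ : Measurable fun z : (Seq 𝒜 n × (Fin (k + 1) → Seq 𝒰 n × I × I)) ×
        ((Seq Se n × Seq S n × Seq Sd n) × (Seq 𝒴 n × Seq 𝒵 n)) =>
        ((((z.1.1, z.2.1), (hit z.1 z.2.1.1).1),
          φ ((hit z.1 z.2.1.1).1, z.2.1.1) (hit z.1 z.2.1.1).2.1), z.2.2) := by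
      have h1 : Measurable fun z : (Seq 𝒜 n × (Fin (k + 1) → Seq 𝒰 n × I × I)) ×
          ((Seq Se n × Seq S n × Seq Sd n) × (Seq 𝒴 n × Seq 𝒵 n)) => (hit z.1 z.2.1.1).1 :=
        hsel.comp (f := fun z : (Seq 𝒜 n × (Fin (k + 1) → Seq 𝒰 n × I × I)) ×
          ((Seq Se n × Seq S n × Seq Sd n) × (Seq 𝒴 n × Seq 𝒵 n)) => (z.1, z.2.1.1))
          (by fun_prop)
      have h2 : Measurable fun z : (Seq 𝒜 n × (Fin (k + 1) → Seq 𝒰 n × I × I)) ×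
          ((Seq Se n × Seq S n × Seq Sd n) × (Seq 𝒴 n × Seq 𝒵 n)) =>
          φ ((hit z.1 z.2.1.1).1, z.2.1.1) (hit z.1 z.2.1.1).2.1 :=
        henc.comp (f := fun z : (Seq 𝒜 n × (Fin (k + 1) → Seq 𝒰 n × I × I)) ×
          ((Seq Se n × Seq S n × Seq Sd n) × (Seq 𝒴 n × Seq 𝒵 n)) => (z.1, z.2.1.1))
          (by fun_prop)
      fun_prop
    have hswap : Measurable fun r : Seq 𝒜 n × (Seq Se n × Seq S n × Seq Sd n) ×
        (Fin (k + 1) → Seq 𝒰 n × I × I) =>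
        f (((r.1, r.2.1), (hit (r.1, r.2.2) r.2.1.1).1), (hit (r.1, r.2.2) r.2.1.1).2.1) := by
      have h1 : Measurable fun r : Seq 𝒜 n × (Seq Se n × Seq S n × Seq Sd n) ×
          (Fin (k + 1) → Seq 𝒰 n × I × I) => hit (r.1, r.2.2) r.2.1.1 :=
        hhit.comp (g := Function.uncurry hit) (f := fun r : Seq 𝒜 n ×
          (Seq Se n × Seq S n × Seq Sd n) × (Fin (k + 1) → Seq 𝒰 n × I × I) =>
          ((r.1, r.2.2), r.2.1.1)) (by fun_prop)
      fun_prop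
    rw [Measure.map_apply hΨ hE, Measure.compProd_apply (hΨ hE), codewordLaw,
      Measure.lintegral_compProd (Kernel.measurable_kernel_prodMk_left (hΨ hE)),
      Measure.lintegral_compProd]
    · refine lintegral_congr fun a => ?_
      refine Eq.trans ?_ (lintegral_lintegral_swap
        (μ := iidKernel (entryKernel (p.auxGivenAct n)) (k + 1) a) (ν := M.state n a)
        (f := fun b w => f (((a, w), (hit (a, b) w.1).1), (hit (a, b) w.1).2.1))
        (hswap.comp (f := fun r : (Fin (k + 1) → Seq 𝒰 n × I × I) ×
          (Seq Se n × Seq S n × Seq Sd n) => (a, r.2, r.1)) (by fun_prop)).aemeasurable)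
      refine lintegral_congr fun b => ?_
      rw [outKernel_apply, Measure.compProd_apply (measurable_prodMk_left (hΨ hE))]
      rfl
    · exact Measurable.lintegral_kernel_prod_right'
        (κ := (iidKernel (entryKernel (p.auxGivenAct n)) (k + 1)).comap Prod.fst measurable_fst)
        (f := fun r : (Seq 𝒜 n × (Seq Se n × Seq S n × Seq Sd n)) ×
          (Fin (k + 1) → Seq 𝒰 n × I × I) =>
          f ((r.1, (hit (r.1.1, r.2) r.1.2.1).1), (hit (r.1.1, r.2) r.1.2.1).2.1))
        (hswap.comp (f := fun r : (Seq 𝒜 n × (Seq Se n × Seq S n × Seq Sd n)) ×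
          (Fin (k + 1) → Seq 𝒰 n × I × I) => (r.1.1, r.1.2, r.2)) (by fun_prop))
  rw [Measure.smul_apply, smul_eq_mul, hleft, hright]
  exact hcov f hf

lemma map_act_aux_jointLaw (n : ℕ) :
    (p.jointLaw n).map (fun ω => (ω.1.1.1.1, ω.1.1.2)) = p.act n ⊗ₘ p.auxGivenAct n := by
  have h1 : (p.jointLaw n).map (fun ω => (ω.1.1.1.1, ω.1.1.2)) =
      (p.jointLaw n).fst.fst.map fun z => (z.1.1, z.2) := by
    rw [Measure.fst, Measure.fst, Measure.map_map measurable_fst measurable_fst,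
      Measure.map_map (by fun_prop) (by fun_prop)]
    rfl
  rw [h1, jointLaw, Measure.fst_compProd, Measure.fst_compProd]
  ext E hE
  have hm : Measurable fun z : (Seq 𝒜 n × (Seq Se n × Seq S n × Seq Sd n)) × Seq 𝒰 n =>
      (z.1.1, z.2) := by fun_prop
  rw [Measure.map_apply hm hE, Measure.compProd_apply (hm hE), Measure.lintegral_compProd
    (Kernel.measurable_kernel_prodMk_left (hm hE)), Measure.compProd_apply hE]
  refine lintegral_congr fun a => ?_
  have hEa : MeasurableSet (Prod.mk a ⁻¹' E) := measurable_prodMk_left hE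
  rw [auxGivenAct, Kernel.snd_apply' _ _ hEa, Kernel.compProd_apply (measurable_snd hEa),
    Kernel.fst_apply, lintegral_map _ measurable_fst]
  · rfl
  · exact (Kernel.measurable_coe (p.aux n) hEa).comp measurable_prodMk_left

lemma map_entry_codewordLaw (n k : ℕ) (l : Fin (k + 1)) :
    (p.codewordLaw n k).map (fun x => (x.1, (x.2 l).1)) = p.act n ⊗ₘ p.auxGivenAct n := by
  have hm : Measurable fun b : Fin (k + 1) → Seq 𝒰 n × I × I => (b l).1 := by fun_prop
  have hker : (iidKernel (entryKernel (p.auxGivenAct n)) (k + 1)).map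
      (fun b : Fin (k + 1) → Seq 𝒰 n × I × I => (b l).1) = p.auxGivenAct n := by
    ext1 a
    have h1 := (measurePreserving_eval
      (fun _ : Fin (k + 1) => entryKernel (p.auxGivenAct n) a) l).map_eq
    rw [Kernel.map_apply _ hm, iidKernel_apply]
    calc (Measure.pi fun _ : Fin (k + 1) => entryKernel (p.auxGivenAct n) a).map
          (fun b : Fin (k + 1) → Seq 𝒰 n × I × I => (b l).1)
        = ((Measure.pi fun _ : Fin (k + 1) => entryKernel (p.auxGivenAct n) a).map
            (Function.eval l)).map Prod.fst := by
          rw [Measure.map_map measurable_fst (measurable_pi_apply l)]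
          rfl
      _ = (entryKernel (p.auxGivenAct n)).fst a := by rw [h1, Kernel.fst_apply]
      _ = p.auxGivenAct n a := by rw [entryKernel, Kernel.fst_prod]
  conv_rhs => rw [← hker]
  rw [Measure.compProd_map hm]
  rfl

/-- **One-shot achievability.** For a process, a rejection threshold `T` valid on `s`, a decoding
test `t` and list and codebook sizes `k + 1` and `N + 1`, there is a code whose error probability,
weighted by `a`, and expected distortion add up to at most the expected distortion of the process
plus the terms of the random coding analysis. -/
lemma exists_code [StandardBorelSpace 𝒳] (n k N : ℕ) {T : ℝ} (hT : 1 ≤ T)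
    {s : Set ((Seq 𝒜 n × Seq Se n) × Seq 𝒰 n)} (hs : MeasurableSet s)
    (h : ((p.act n ⊗ₘ (M.state n).fst) ⊗ₘ p.aux n).restrict s ≤
      ENNReal.ofReal T •
        ((p.act n ⊗ₘ (M.state n).fst) ⊗ₘ (p.auxGivenAct n).comap Prod.fst measurable_fst))
    {t : Set ((Seq 𝒜 n × Seq 𝒰 n) × (Seq 𝒴 n × Seq Sd n))} (ht : MeasurableSet t)
    {b : ℝ} (hb : ∀ x y, M.dist n x y ≤ b) (a : ℝ≥0∞) {δ : ℝ≥0∞}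
    (hδ : δ = ENNReal.ofReal ((1 - 1 / T) ^ (k + 1)) +
      p.jointLaw n {ω | ((ω.1.1.1.1, ω.1.1.1.2.1), ω.1.1.2) ∈ s}ᶜ) :
    ∃ c : Code M n, c.size = N + 1 ∧
      a * ENNReal.ofReal c.errorProb + ENNReal.ofReal c.expDistortion ≤
        a * ((p.decLaw n tᶜ + δ) + δ +
          N * ((k + 1) * ((p.decLaw n).fst.prod (p.decLaw n).snd) t)) +
        (ENNReal.ofReal (p.expDistortion n) + ENNReal.ofReal b * δ) := by
  obtain ⟨sel, enc, hsel, henc, hl, hdom⟩ := p.exists_ensemble n k hT hs h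
  have hT0 : 0 < T := by linarith
  have hr : 0 ≤ 1 - 1 / T ∧ 1 - 1 / T ≤ 1 := by
    rw [sub_nonneg, div_le_one hT0]
    refine ⟨hT, ?_⟩
    have : 0 ≤ 1 / T := by positivity
    linarith
  set G := p.codewordLaw n k
  set Vf := M.outKernel n measurable_fst henc
  let view : (Seq Se n × Seq S n × Seq Sd n) × (Seq 𝒴 n × Seq 𝒵 n) → Seq 𝒴 n × Seq Sd n :=
    fun o => (o.2.1, o.1.2.2)
  have hview : Measurable view := by fun_prop
  let Ψ : (Seq 𝒜 n × (Fin (k + 1) → Seq 𝒰 n × I × I)) ×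
      ((Seq Se n × Seq S n × Seq Sd n) × (Seq 𝒴 n × Seq 𝒵 n)) →
      (((Seq 𝒜 n × (Seq Se n × Seq S n × Seq Sd n)) × Seq 𝒰 n) × Seq 𝒳 n) ×
        (Seq 𝒴 n × Seq 𝒵 n) :=
    fun z => ((((z.1.1, z.2.1), sel z.1 z.2.1.1), enc z.1 z.2.1.1), z.2.2)
  have hΨ : Measurable Ψ := by
    have h1 : Measurable fun z : (Seq 𝒜 n × (Fin (k + 1) → Seq 𝒰 n × I × I)) ×
        ((Seq Se n × Seq S n × Seq Sd n) × (Seq 𝒴 n × Seq 𝒵 n)) => sel z.1 z.2.1.1 :=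
      hsel.comp (f := fun z : (Seq 𝒜 n × (Fin (k + 1) → Seq 𝒰 n × I × I)) ×
        ((Seq Se n × Seq S n × Seq Sd n) × (Seq 𝒴 n × Seq 𝒵 n)) => (z.1, z.2.1.1)) (by fun_prop)
    have h2 : Measurable fun z : (Seq 𝒜 n × (Fin (k + 1) → Seq 𝒰 n × I × I)) ×
        ((Seq Se n × Seq S n × Seq Sd n) × (Seq 𝒴 n × Seq 𝒵 n)) => enc z.1 z.2.1.1 :=
      henc.comp (f := fun z : (Seq 𝒜 n × (Fin (k + 1) → Seq 𝒰 n × I × I)) ×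
        ((Seq Se n × Seq S n × Seq Sd n) × (Seq 𝒴 n × Seq 𝒵 n)) => (z.1, z.2.1.1)) (by fun_prop)
    fun_prop
  have : IsProbabilityMeasure ((G ⊗ₘ Vf).map Ψ) :=
    Measure.isProbabilityMeasure_map hΨ.aemeasurable
  have hs' : MeasurableSet {ω : (((Seq 𝒜 n × (Seq Se n × Seq S n × Seq Sd n)) × Seq 𝒰 n) ×
      Seq 𝒳 n) × (Seq 𝒴 n × Seq 𝒵 n) | ((ω.1.1.1.1, ω.1.1.1.2.1), ω.1.1.2) ∈ s} :=
    (by fun_prop : Measurable fun ω : (((Seq 𝒜 n × (Seq Se n × Seq S n × Seq Sd n)) × Seq 𝒰 n) ×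
      Seq 𝒳 n) × (Seq 𝒴 n × Seq 𝒵 n) => ((ω.1.1.1.1, ω.1.1.1.2.1), ω.1.1.2)) hs
  have hclose : ∀ {f : (((Seq 𝒜 n × (Seq Se n × Seq S n × Seq Sd n)) × Seq 𝒰 n) × Seq 𝒳 n) ×
      (Seq 𝒴 n × Seq 𝒵 n) → ℝ≥0∞} {b : ℝ≥0∞}, (∀ ω, f ω ≤ b) →
      ∫⁻ ω, f ω ∂((G ⊗ₘ Vf).map Ψ) ≤ ∫⁻ ω, f ω ∂(p.jointLaw n) + b * δ := by
    intro f b hf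
    rw [hδ]
    exact lintegral_le_of_smul_restrict_le (pow_nonneg hr.1 _) (pow_le_one₀ hr.1 hr.2) hs' hdom hf
  have hcloseE : ∀ {E : Set ((((Seq 𝒜 n × (Seq Se n × Seq S n × Seq Sd n)) × Seq 𝒰 n) × Seq 𝒳 n) ×
      (Seq 𝒴 n × Seq 𝒵 n))}, MeasurableSet E →
      (G ⊗ₘ Vf) (Ψ ⁻¹' E) ≤ p.jointLaw n E + δ := by
    intro E hE
    have := hclose (f := E.indicator 1) (b := 1) fun ω => Set.indicator_le_self' (by simp) ω
    rwa [lintegral_indicator_one hE, lintegral_indicator_one hE, one_mul,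
      Measure.map_apply hΨ hE] at this
  let S' : Set ((Seq 𝒜 n × (Fin (k + 1) → Seq 𝒰 n × I × I)) × (Seq 𝒴 n × Seq Sd n)) :=
    ⋃ l, Prod.map (fun x => (x.1, (x.2 l).1)) id ⁻¹' t
  have hpm : ∀ l : Fin (k + 1), Measurable
      (Prod.map (fun x : Seq 𝒜 n × (Fin (k + 1) → Seq 𝒰 n × I × I) => (x.1, (x.2 l).1))
        (id : Seq 𝒴 n × Seq Sd n → Seq 𝒴 n × Seq Sd n)) := fun l => by fun_prop
  have hS' : MeasurableSet S' := MeasurableSet.iUnion fun l => hpm l ht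
  have hq : Measurable fun ω : (((Seq 𝒜 n × (Seq Se n × Seq S n × Seq Sd n)) × Seq 𝒰 n) ×
      Seq 𝒳 n) × (Seq 𝒴 n × Seq 𝒵 n) => ((ω.1.1.1.1, ω.1.1.2), (ω.2.1, ω.1.1.1.2.2.2)) := by
    fun_prop
  have hdist : Measurable fun ω : (((Seq 𝒜 n × (Seq Se n × Seq S n × Seq Sd n)) × Seq 𝒰 n) ×
      Seq 𝒳 n) × (Seq 𝒴 n × Seq 𝒵 n) =>
      M.dist n ω.1.1.1.2.2.1 (p.est n (ω.1.2, ω.1.1.1.1, ω.1.1.1.2.1, ω.2.2)) := by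
    have h1 := p.est_measurable n
    exact (M.dist_measurable n).comp (f := fun ω : (((Seq 𝒜 n × (Seq Se n × Seq S n × Seq Sd n)) ×
      Seq 𝒰 n) × Seq 𝒳 n) × (Seq 𝒴 n × Seq 𝒵 n) =>
      (ω.1.1.1.2.2.1, p.est n (ω.1.2, ω.1.1.1.1, ω.1.1.1.2.1, ω.2.2))) (by fun_prop)
  let D : (Seq 𝒜 n × (Fin (k + 1) → Seq 𝒰 n × I × I)) ×
      ((Seq Se n × Seq S n × Seq Sd n) × (Seq 𝒴 n × Seq 𝒵 n)) → ℝ := fun z =>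
    M.dist n z.2.1.2.1 (p.est n (enc z.1 z.2.1.1, z.1.1, z.2.1.1, z.2.2.2))
  have hD : Measurable D := hdist.comp hΨ
  have : IsMarkovKernel (Vf.map view) := Kernel.IsMarkovKernel.map Vf hview
  have hVmap : G ⊗ₘ Vf.map view = (G ⊗ₘ Vf).map (Prod.map id view) := Measure.compProd_map hview
  obtain ⟨cw, dec, hdec, hcw⟩ := exists_codebook G (Vf.map view) hS' (p.decLaw n).snd δ
    (fun E hE => by
      have hE' : MeasurableSet ((fun ω : (((Seq 𝒜 n × (Seq Se n × Seq S n × Seq Sd n)) × Seq 𝒰 n) ×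
          Seq 𝒳 n) × (Seq 𝒴 n × Seq 𝒵 n) => (ω.2.1, ω.1.1.1.2.2.2)) ⁻¹' E) :=
        hq.snd hE
      have h1 : ∫⁻ x, Vf.map view x E ∂G =
          (G ⊗ₘ Vf) (Ψ ⁻¹' ((fun ω => (ω.2.1, ω.1.1.1.2.2.2)) ⁻¹' E)) := by
        rw [Measure.compProd_apply (hΨ hE')]
        refine lintegral_congr fun x => ?_
        rw [Kernel.map_apply' _ hview _ hE]
        rfl
      rw [h1, decLaw, Measure.snd, Measure.map_map measurable_snd hq,
        Measure.map_apply (measurable_snd.comp hq) hE]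
      exact hcloseE hE') (cost := fun x => ∫⁻ o, ENNReal.ofReal (D (x, o)) ∂(Vf x))
    (Measurable.lintegral_kernel_prod_right' (κ := Vf) (f := fun z => ENNReal.ofReal (D z))
      (by fun_prop)) a N
  have hmiss : (G ⊗ₘ Vf.map view) S'ᶜ ≤ p.decLaw n tᶜ + δ := by
    have ht' : MeasurableSet ((fun ω : (((Seq 𝒜 n × (Seq Se n × Seq S n × Seq Sd n)) × Seq 𝒰 n) ×
        Seq 𝒳 n) × (Seq 𝒴 n × Seq 𝒵 n) => ((ω.1.1.1.1, ω.1.1.2), (ω.2.1, ω.1.1.1.2.2.2))) ⁻¹' tᶜ) :=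
      hq ht.compl
    rw [hVmap, Measure.map_apply (measurable_id.prodMap hview) hS'.compl, decLaw,
      Measure.map_apply hq ht.compl]
    refine le_trans (measure_mono fun z hz => ?_) (hcloseE ht')
    -- The selected entry is one of the list, so it fails the test if all entries do.
    obtain ⟨l, hl'⟩ := hl z.1 z.2.1.1
    intro hzt
    refine hz (Set.mem_iUnion.2 ⟨l, ?_⟩)
    change ((z.1.1, sel z.1 z.2.1.1), (z.2.2.1, z.2.1.2.2)) ∈ t at hzt
    rw [hl'] at hzt
    exact hzt
  have hfalse : (G.prod (p.decLaw n).snd) S' ≤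
      (k + 1) * ((p.decLaw n).fst.prod (p.decLaw n).snd) t := by
    have hfst : ∀ l : Fin (k + 1), G.map (fun x => (x.1, (x.2 l).1)) = (p.decLaw n).fst := by
      intro l
      rw [p.map_entry_codewordLaw n k l, ← p.map_act_aux_jointLaw, decLaw, Measure.fst,
        Measure.map_map measurable_fst hq]
      rfl
    refine (measure_iUnion_fintype_le _ _).trans (le_of_eq ?_)
    have hterm : ∀ l : Fin (k + 1), (G.prod (p.decLaw n).snd)
        (Prod.map (fun x => (x.1, (x.2 l).1)) id ⁻¹' t) =
        ((p.decLaw n).fst.prod (p.decLaw n).snd) t := by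
      intro l
      rw [← Measure.map_apply (hpm l) ht, ← Measure.map_prod_map _ _ (by fun_prop) measurable_id,
        hfst l, Measure.map_id]
    simp only [hterm, Finset.sum_const, Finset.card_univ, Fintype.card_fin, nsmul_eq_mul]
    push_cast
    rfl
  have hcost : ∫⁻ x, ∫⁻ o, ENNReal.ofReal (D (x, o)) ∂(Vf x) ∂G ≤
      ENNReal.ofReal (p.expDistortion n) + ENNReal.ofReal b * δ := by
    rw [← Measure.lintegral_compProd (f := fun z => ENNReal.ofReal (D z)) (by fun_prop)]
    have h1 := hclose (f := fun ω => ENNReal.ofReal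
      (M.dist n ω.1.1.1.2.2.1 (p.est n (ω.1.2, ω.1.1.1.1, ω.1.1.1.2.1, ω.2.2))))
      (b := ENNReal.ofReal b) fun ω => ENNReal.ofReal_le_ofReal (hb _ _)
    rw [lintegral_map hdist.ennreal_ofReal hΨ] at h1
    refine h1.trans (le_of_eq ?_)
    rw [expDistortion, ofReal_integral_eq_lintegral_ofReal]
    · refine Integrable.of_bound hdist.aestronglyMeasurable b (ae_of_all _ fun ω => ?_)
      rw [Real.norm_of_nonneg (M.dist_nonneg _ _ _)]
      exact hb _ _
    · exact ae_of_all _ fun ω => M.dist_nonneg _ _ _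
  let c : Code M n :=
    { size := N + 1
      size_pos := N.succ_pos
      actionSet := Set.univ
      actEnc := fun m => ⟨(cw m).1, trivial⟩
      enc := fun m => enc (cw m)
      enc_measurable := fun m => henc.of_uncurry_left
      dec := dec
      dec_measurable := hdec
      est := p.est n
      est_measurable := p.est_measurable n }
  have hout : ∀ m, c.outLaw m = Vf (cw m) := fun m =>
    (outKernel_apply M n measurable_fst henc (cw m)).symm
  have herr : ENNReal.ofReal c.errorProb =
      ((N : ℝ≥0∞) + 1)⁻¹ * ∑ m, (Vf.map view) (cw m) {o | dec o ≠ m} := by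
    rw [Code.errorProb]
    refine (ofReal_average N.succ_pos fun m => measureReal_nonneg).trans ?_
    rw [Nat.cast_succ]
    congr 1
    refine Finset.sum_congr rfl fun m _ => ?_
    have hset : MeasurableSet {o | dec o ≠ m} := hdec (measurableSet_singleton m).compl
    rw [ofReal_measureReal, hout, Kernel.map_apply' _ hview _ hset]
    rfl
  have hexp : ENNReal.ofReal c.expDistortion =
      ((N : ℝ≥0∞) + 1)⁻¹ * ∑ m, ∫⁻ o, ENNReal.ofReal (D (cw m, o)) ∂(Vf (cw m)) := by
    rw [Code.expDistortion]
    refine (ofReal_average N.succ_pos fun m =>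
      integral_nonneg fun ω => M.dist_nonneg _ _ _).trans ?_
    rw [Nat.cast_succ]
    congr 1
    refine Finset.sum_congr rfl fun m _ => ?_
    rw [hout, ofReal_integral_eq_lintegral_ofReal]
    · refine Integrable.of_bound (hD.comp measurable_prodMk_left).aestronglyMeasurable b
        (ae_of_all _ fun o => ?_)
      rw [Real.norm_of_nonneg (M.dist_nonneg _ _ _)]
      exact hb _ _
    · exact ae_of_all _ fun o => M.dist_nonneg _ _ _
  refine ⟨c, rfl, ?_⟩
  calc a * ENNReal.ofReal c.errorProb + ENNReal.ofReal c.expDistortion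
      = ((N : ℝ≥0∞) + 1)⁻¹ * ∑ m, (a * (Vf.map view) (cw m) {o | dec o ≠ m} +
          ∫⁻ o, ENNReal.ofReal (D (cw m, o)) ∂(Vf (cw m))) := by
        rw [herr, hexp, Finset.sum_add_distrib, ← Finset.mul_sum]
        ring
    _ ≤ ((N : ℝ≥0∞) + 1)⁻¹ * ((N + 1) * (a * ((p.decLaw n tᶜ + δ) + δ +
          N * ((k + 1) * ((p.decLaw n).fst.prod (p.decLaw n).snd) t)) +
        (ENNReal.ofReal (p.expDistortion n) + ENNReal.ofReal b * δ))) := by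
        gcongr
        refine hcw.trans ?_
        gcongr
    _ = _ := by
        rw [← mul_assoc, ENNReal.inv_mul_cancel (by simp) (by finiteness), one_mul]

end AuxProcess

/-! ### Achievability -/

lemma limsup_coe_le_iff {u : ℕ → ℝ} {D : ℝ} :
    limsup (fun n => (u n : EReal)) atTop ≤ D ↔ ∀ e : ℝ, 0 < e → ∀ᶠ n in atTop, u n < D + e := by
  constructor
  · intro h e he
    have hlt : limsup (fun n => (u n : EReal)) atTop < ((D + e : ℝ) : EReal) :=
      h.trans_lt (by exact_mod_cast lt_add_of_pos_right D he)
    filter_upwards [eventually_lt_of_limsup_lt hlt] with n hn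
    exact_mod_cast hn
  · intro h
    refine le_of_forall_gt fun c hc => ?_
    obtain ⟨r, hr1, hr2⟩ := EReal.lt_iff_exists_real_btwn.1 hc
    refine lt_of_le_of_lt (limsup_le_of_le (by isBoundedDefault) ?_) hr2
    have hr : D < r := by exact_mod_cast hr1
    filter_upwards [h (r - D) (by linarith)] with n hn
    have : u n ≤ r := by linarith
    exact_mod_cast this

lemma le_liminf_coe_iff {u : ℕ → ℝ} {R : ℝ} :
    R ≤ liminf (fun n => (u n : EReal)) atTop ↔ ∀ e : ℝ, 0 < e → ∀ᶠ n in atTop, R - e < u n := by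
  constructor
  · intro h e he
    have hlt : ((R - e : ℝ) : EReal) < liminf (fun n => (u n : EReal)) atTop :=
      lt_of_lt_of_le (by exact_mod_cast sub_lt_self R he) h
    filter_upwards [eventually_lt_of_lt_liminf hlt] with n hn
    exact_mod_cast hn
  · intro h
    refine le_of_forall_lt fun c hc => ?_
    obtain ⟨r, hr1, hr2⟩ := EReal.lt_iff_exists_real_btwn.1 hc
    refine lt_of_lt_of_le hr1 (le_liminf_of_le (by isBoundedDefault) ?_)
    have hr : r < R := by exact_mod_cast hr2
    filter_upwards [h (R - r) (by linarith)] with n hn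
    have : r ≤ u n := by linarith
    exact_mod_cast this

lemma tendsto_measure_lt_of_pLimsup_lt {Ω : ℕ → Type*} [∀ n, MeasurableSpace (Ω n)]
    {μ : ∀ n, Measure (Ω n)} {T : ∀ n, Ω n → EReal} {c : EReal} (h : pLimsup μ T < c) :
    Tendsto (fun n => μ n {ω | c < T n ω}) atTop (𝓝 0) := by
  obtain ⟨α, hα, hαc⟩ := sInf_lt_iff.1 h
  exact tendsto_of_tendsto_of_tendsto_of_le_of_le tendsto_const_nhds hα (fun _ => zero_le)
    fun n => measure_mono fun ω hω => hαc.trans hω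

lemma tendsto_measure_lt_of_lt_pLiminf {Ω : ℕ → Type*} [∀ n, MeasurableSpace (Ω n)]
    {μ : ∀ n, Measure (Ω n)} {T : ∀ n, Ω n → EReal} {c : EReal} (h : c < pLiminf μ T) :
    Tendsto (fun n => μ n {ω | T n ω < c}) atTop (𝓝 0) := by
  obtain ⟨β, hβ, hcβ⟩ := lt_sSup_iff.1 h
  exact tendsto_of_tendsto_of_tendsto_of_le_of_le tendsto_const_nhds hβ (fun _ => zero_le)
    fun n => measure_mono fun ω hω => lt_trans hω hcβ

lemma prod_eq_compProd_comap {X Y Z : Type*} [MeasurableSpace X] [MeasurableSpace Y]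
    [MeasurableSpace Z] (K : Kernel X Y) [IsSFiniteKernel K] (η : Kernel X Z) [IsSFiniteKernel η] :
    K ×ₖ η = K ⊗ₖ η.comap Prod.fst measurable_fst := by
  ext a s hs
  rw [Kernel.prod_apply' _ _ _ hs, Kernel.compProd_apply hs]
  rfl

namespace Code

variable {M : Model 𝒜 Se S Sd 𝒳 𝒴 𝒵 Sh} {n : ℕ} (c : Code M n)

lemma errorProb_nonneg : 0 ≤ c.errorProb :=
  mul_nonneg (by positivity) (Finset.sum_nonneg fun _ _ => measureReal_nonneg)

lemma expDistortion_nonneg : 0 ≤ c.expDistortion :=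
  mul_nonneg (by positivity) (Finset.sum_nonneg fun _ _ =>
    integral_nonneg fun _ => M.dist_nonneg _ _ _)

end Code

namespace AuxProcess

variable {M : Model 𝒜 Se S Sd 𝒳 𝒴 𝒵 Sh} {𝒰 : Type*} [MeasurableSpace 𝒰] (p : AuxProcess M 𝒰)

/-- The law of `(A^n, (S_e^n, U^n))`. -/
noncomputable def encLaw (n : ℕ) : Measure (Seq 𝒜 n × (Seq Se n × Seq 𝒰 n)) :=
  p.act n ⊗ₘ ((M.state n).fst ⊗ₖ p.aux n)

/-- The law of `(A^n, (S_e^n, U^n))` if `S_e^n` and `U^n` were independent given `A^n`. -/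
noncomputable def encLawIndep (n : ℕ) : Measure (Seq 𝒜 n × (Seq Se n × Seq 𝒰 n)) :=
  p.act n ⊗ₘ ((M.state n).fst ×ₖ ((M.state n).fst ⊗ₖ p.aux n).snd)

instance (n : ℕ) : IsProbabilityMeasure (p.encLaw n) := by
  unfold encLaw
  infer_instance

instance (n : ℕ) : IsProbabilityMeasure (p.encLawIndep n) := by
  unfold encLawIndep
  infer_instance

lemma map_encLaw (n : ℕ) :
    (p.jointLaw n).map (fun ω => (ω.1.1.1.1, (ω.1.1.1.2.1, ω.1.1.2))) = p.encLaw n := by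
  have h1 : (p.jointLaw n).map (fun ω => (ω.1.1.1.1, (ω.1.1.1.2.1, ω.1.1.2))) =
      (p.jointLaw n).fst.fst.map fun z => (z.1.1, (z.1.2.1, z.2)) := by
    rw [Measure.fst, Measure.fst, Measure.map_map measurable_fst measurable_fst,
      Measure.map_map (by fun_prop) (by fun_prop)]
    rfl
  rw [h1, jointLaw, Measure.fst_compProd, Measure.fst_compProd, encLaw]
  ext E hE
  have hm : Measurable fun z : (Seq 𝒜 n × (Seq Se n × Seq S n × Seq Sd n)) × Seq 𝒰 n =>
      (z.1.1, (z.1.2.1, z.2)) := by fun_prop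
  rw [Measure.map_apply hm hE, Measure.compProd_apply (hm hE), Measure.lintegral_compProd
    (Kernel.measurable_kernel_prodMk_left (hm hE)), Measure.compProd_apply hE]
  refine lintegral_congr fun a => ?_
  have hEa : MeasurableSet (Prod.mk a ⁻¹' E) := measurable_prodMk_left hE
  rw [Kernel.compProd_apply hEa, Kernel.fst_apply, lintegral_map _ measurable_fst]
  · rfl
  · have hms : Measurable fun x : Seq 𝒜 n × Seq Se n =>
        p.aux n x {u | (x.1, (x.2, u)) ∈ E} :=
      Kernel.measurable_kernel_prodMk_left (κ := p.aux n)
        (t := (fun r : (Seq 𝒜 n × Seq Se n) × Seq 𝒰 n => (r.1.1, (r.1.2, r.2))) ⁻¹' E)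
        ((by fun_prop : Measurable fun r : (Seq 𝒜 n × Seq Se n) × Seq 𝒰 n =>
          (r.1.1, (r.1.2, r.2))) hE)
    exact hms.comp (measurable_prodMk_left (x := a) :
      Measurable (Prod.mk a : Seq Se n → Seq 𝒜 n × Seq Se n))

/-- One-shot achievability with the acceptance region and the decoding test given by thresholds on
the two log-likelihood ratios. -/
lemma exists_code_of_thresholds [StandardBorelSpace 𝒳] (n k N : ℕ) {t : ℝ} (ht : 0 ≤ t) (β : ℝ)
    {b : ℝ} (hb : ∀ x y, M.dist n x y ≤ b) (a : ℝ≥0∞) {δ : ℝ≥0∞}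
    (hδ : δ = ENNReal.ofReal ((1 - 1 / Real.exp t) ^ (k + 1)) +
      p.encLaw n {ω | (t : EReal) < logRatio (p.encLaw n) (p.encLawIndep n) ω}) :
    ∃ c : Code M n, c.size = N + 1 ∧
      a * ENNReal.ofReal c.errorProb + ENNReal.ofReal c.expDistortion ≤
        a * ((p.decLaw n {ω |
          logRatio (p.decLaw n) ((p.decLaw n).fst.prod (p.decLaw n).snd) ω < β} +
          δ) + δ + N * ((k + 1) * ENNReal.ofReal (Real.exp (-β)))) +
        (ENNReal.ofReal (p.expDistortion n) + ENNReal.ofReal b * δ) := by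
  let e : ((Seq 𝒜 n × Seq Se n) × Seq 𝒰 n) ≃ᵐ Seq 𝒜 n × (Seq Se n × Seq 𝒰 n) :=
    MeasurableEquiv.prodAssoc
  have hL := measurable_logRatio (p.encLaw n) (p.encLawIndep n)
  have hB : MeasurableSet {ω | logRatio (p.encLaw n) (p.encLawIndep n) ω ≤ (t : EReal)} :=
    measurableSet_le hL measurable_const
  have hs := e.measurable hB
  have hT : 1 ≤ Real.exp t := Real.one_le_exp ht
  have hdom : ((p.act n ⊗ₘ (M.state n).fst) ⊗ₘ p.aux n).restrict
      (e ⁻¹' {ω | logRatio (p.encLaw n) (p.encLawIndep n) ω ≤ (t : EReal)}) ≤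
      ENNReal.ofReal (Real.exp t) •
        ((p.act n ⊗ₘ (M.state n).fst) ⊗ₘ (p.auxGivenAct n).comap Prod.fst measurable_fst) := by
    have h1 : (p.act n ⊗ₘ (M.state n).fst) ⊗ₘ p.aux n =
        (p.encLaw n).map MeasurableEquiv.prodAssoc.symm := (Measure.compProd_assoc).symm
    have h2 : (p.act n ⊗ₘ (M.state n).fst) ⊗ₘ (p.auxGivenAct n).comap Prod.fst measurable_fst =
        (p.encLawIndep n).map MeasurableEquiv.prodAssoc.symm := by
      rw [encLawIndep, prod_eq_compProd_comap, Measure.compProd_assoc]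
      rfl
    refine Measure.le_iff.2 fun E hE => ?_
    rw [Measure.restrict_apply hE, Measure.smul_apply, smul_eq_mul, h1, h2,
      MeasurableEquiv.map_apply, MeasurableEquiv.map_apply]
    exact measure_inter_logRatio_le (p.encLaw n) (p.encLawIndep n) t _
  have hm : Measurable fun ω : (((Seq 𝒜 n × (Seq Se n × Seq S n × Seq Sd n)) × Seq 𝒰 n) ×
      Seq 𝒳 n) × (Seq 𝒴 n × Seq 𝒵 n) => (ω.1.1.1.1, (ω.1.1.1.2.1, ω.1.1.2)) := by fun_prop
  have hδ' : δ = ENNReal.ofReal ((1 - 1 / Real.exp t) ^ (k + 1)) +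
      p.jointLaw n {ω | ((ω.1.1.1.1, ω.1.1.1.2.1), ω.1.1.2) ∈
        e ⁻¹' {ω | logRatio (p.encLaw n) (p.encLawIndep n) ω ≤ (t : EReal)}}ᶜ := by
    have hset : {ω | (t : EReal) < logRatio (p.encLaw n) (p.encLawIndep n) ω} =
        {ω | logRatio (p.encLaw n) (p.encLawIndep n) ω ≤ (t : EReal)}ᶜ := by
      ext ω
      simp
    rw [hδ, hset]
    congr 1
    have h3 := congrArg (fun μ : Measure (Seq 𝒜 n × (Seq Se n × Seq 𝒰 n)) =>
      μ {ω | logRatio (p.encLaw n) (p.encLawIndep n) ω ≤ (t : EReal)}ᶜ) (p.map_encLaw n)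
    simp only [Measure.map_apply hm hB.compl] at h3
    exact h3.symm
  have htm : MeasurableSet {ω | (β : EReal) ≤
      logRatio (p.decLaw n) ((p.decLaw n).fst.prod (p.decLaw n).snd) ω} :=
    measurableSet_le measurable_const (measurable_logRatio _ _)
  obtain ⟨c, hc, hle⟩ := p.exists_code n k N hT hs hdom htm hb a hδ'
  refine ⟨c, hc, hle.trans ?_⟩
  gcongr
  · intro ω hω
    exact lt_of_not_ge (Set.notMem_ofPred_iff.1 hω)
  · have := measure_inter_le_logRatio (p.decLaw n) ((p.decLaw n).fst.prod (p.decLaw n).snd) β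
      Set.univ
    simpa using this

lemma expDistortion_nonneg (n : ℕ) : 0 ≤ p.expDistortion n :=
  integral_nonneg fun _ => M.dist_nonneg _ _ _

lemma expDistortion_le {n : ℕ} {b : ℝ} (hb : ∀ x y, M.dist n x y ≤ b) :
    p.expDistortion n ≤ b := by
  have h := integral_mono_of_nonneg (μ := p.jointLaw n) (ae_of_all _ fun ω =>
    M.dist_nonneg n ω.1.1.1.2.2.1 (p.est n (ω.1.2, ω.1.1.1.1, ω.1.1.1.2.1, ω.2.2)))
    (integrable_const b) (ae_of_all _ fun ω => hb _ _)
  rw [expDistortion]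
  simpa using h

lemma one_sub_inv_exp_pow_le (n : ℕ) {t g : ℝ} (ht : 0 ≤ t) {k : ℕ}
    (hk : Real.exp (n * (t + g)) ≤ k + 1) :
    (1 - 1 / Real.exp (n * t)) ^ (k + 1) ≤ Real.exp (-Real.exp (n * g)) := by
  have h0 : 0 ≤ 1 - 1 / Real.exp (n * t) := by
    rw [sub_nonneg, div_le_one (Real.exp_pos _)]
    exact Real.one_le_exp (by positivity)
  calc (1 - 1 / Real.exp (n * t)) ^ (k + 1)
      ≤ Real.exp (-(1 / Real.exp (n * t))) ^ (k + 1) :=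
        pow_le_pow_left₀ h0 (Real.one_sub_le_exp_neg _) _
    _ = Real.exp (-((k + 1) / Real.exp (n * t))) := by
        rw [← Real.exp_nat_mul]
        push_cast
        congr 1
        ring
    _ ≤ Real.exp (-Real.exp (n * g)) := by
        refine Real.exp_le_exp.2 (neg_le_neg ?_)
        rw [le_div_iff₀ (Real.exp_pos _), ← Real.exp_add]
        refine le_trans (le_of_eq ?_) hk
        congr 1
        ring

/-- **Achievability.** Every rate below the difference of the two spectral rates of a process that
meets the distortion constraint is achievable. -/
theorem avgAchievable_of_lt [StandardBorelSpace 𝒳] (hM : M.UniformlyBounded) {D : ℝ}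
    (hD : p.MeetsDistortion D) {R : ℝ} (hR : (R : EReal) < p.infRateActAux - p.supRateCond) :
    M.AvgAchievable R D := by
  obtain ⟨Dmax, hDmax, hdist⟩ := hM
  have hb : ∀ n : ℕ, 1 ≤ n → ∀ x y, M.dist n x y ≤ n * Dmax := by
    intro n hn x y
    have hn' : (0 : ℝ) < n := by exact_mod_cast hn
    have := hdist n hn x y
    rwa [one_div, inv_mul_le_iff₀ hn'] at this
  -- The constants: `x` is the subtracted rate, `β` lies below the information rate, and the gap
  -- `4 * g = β - R - x` is shared between the list size and the decoding test.
  obtain ⟨x, hx⟩ : ∃ x : ℝ, p.supRateCond = x := by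
    have h1 : p.supRateCond ≠ ⊥ := (lt_of_lt_of_le (by simp) p.supRateCond_nonneg).ne'
    have h2 : p.supRateCond ≠ ⊤ := by
      intro h
      rw [h, EReal.sub_top] at hR
      exact absurd hR (by simp)
    exact ⟨_, (EReal.coe_toReal h2 h1).symm⟩
  have hx0 : 0 ≤ x := by
    have := p.supRateCond_nonneg
    rw [hx] at this
    exact_mod_cast this
  have hRx : ((R + x : ℝ) : EReal) < p.infRateActAux := by
    rw [hx, EReal.lt_sub_iff_add_lt (by simp) (by simp)] at hR
    exact_mod_cast hR
  obtain ⟨β, hβ1, hβ2⟩ := EReal.lt_iff_exists_real_btwn.1 hRx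
  have hβ : R + x < β := by exact_mod_cast hβ1
  obtain ⟨g, hg0, hg⟩ : ∃ g : ℝ, 0 < g ∧ β = R + x + 4 * g :=
    ⟨(β - R - x) / 4, by linarith, by ring⟩
  obtain ⟨t, ht⟩ : ∃ t : ℝ, t = x + g := ⟨_, rfl⟩
  have ht0 : 0 ≤ t := by linarith
  let A : ℕ → ℝ≥0∞ := fun n =>
    p.encLaw n {ω | ((n * t : ℝ) : EReal) < logRatio (p.encLaw n) (p.encLawIndep n) ω}
  have hA : Tendsto A atTop (𝓝 0) := by
    have hlt : p.supRateCond < (t : EReal) := by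
      rw [hx]
      exact_mod_cast (by linarith : x < t)
    refine (tendsto_measure_lt_of_pLimsup_lt hlt).congr' ?_
    filter_upwards [eventually_ge_atTop 1] with n hn
    refine congrArg (p.encLaw n) (Set.ext fun ω => ?_)
    exact (not_le.symm.trans (not_congr (one_div_mul_le_coe_iff hn _ _))).trans not_le
  let B : ℕ → ℝ≥0∞ := fun n => p.decLaw n {ω |
    logRatio (p.decLaw n) ((p.decLaw n).fst.prod (p.decLaw n).snd) ω < ((n * β : ℝ) : EReal)}
  have hB : Tendsto B atTop (𝓝 0) := by
    refine (tendsto_measure_lt_of_lt_pLiminf hβ2).congr' ?_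
    filter_upwards [eventually_ge_atTop 1] with n hn
    refine congrArg (p.decLaw n) (Set.ext fun ω => ?_)
    exact (not_le.symm.trans (not_congr (coe_le_one_div_mul_iff hn _ _))).trans not_le
  let k : ℕ → ℕ := fun n => ⌈Real.exp (n * (t + g))⌉₊
  let N : ℕ → ℕ := fun n => ⌈Real.exp (n * R)⌉₊ - 1
  have hNpos : ∀ n, N n + 1 = ⌈Real.exp (n * R)⌉₊ := fun n =>
    Nat.sub_add_cancel (Nat.ceil_pos.2 (Real.exp_pos _))
  let r : ℕ → ℝ := fun n => (1 - 1 / Real.exp (n * t)) ^ (k n + 1)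
  have hr0 : ∀ n, 0 ≤ r n := by
    intro n
    refine pow_nonneg ?_ _
    rw [sub_nonneg, div_le_one (Real.exp_pos _)]
    exact Real.one_le_exp (by positivity)
  have hr : Tendsto r atTop (𝓝 0) := by
    have hlim : Tendsto (fun n : ℕ => Real.exp (-Real.exp (n * g))) atTop (𝓝 0) :=
      Real.tendsto_exp_neg_atTop_nhds_zero.comp (Real.tendsto_exp_atTop.comp
        (tendsto_natCast_atTop_atTop.atTop_mul_const hg0))
    refine squeeze_zero hr0 (fun n => one_sub_inv_exp_pow_le n ht0 ?_) hlim
    have := Nat.le_ceil (Real.exp (n * (t + g)))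
    exact this.trans (by simp [k])
  let d : ℕ → ℝ := fun n => r n + (A n).toReal
  have hd0 : ∀ n, 0 ≤ d n := fun n => add_nonneg (hr0 n) ENNReal.toReal_nonneg
  have hd : Tendsto d atTop (𝓝 0) := by
    have := hr.add ((ENNReal.tendsto_toReal ENNReal.zero_ne_top).comp hA)
    simpa using this
  let q : ℕ → ℝ := fun n => N n * ((k n + 1) * Real.exp (-(n * β)))
  have hq0 : ∀ n, 0 ≤ q n := fun n => by positivity
  have hq : Tendsto q atTop (𝓝 0) := by
    have hlim : Tendsto (fun n : ℕ => 3 * Real.exp (-(n * (2 * g)))) atTop (𝓝 0) := by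
      have := (Real.tendsto_exp_neg_atTop_nhds_zero.comp
        (tendsto_natCast_atTop_atTop.atTop_mul_const (by positivity : 0 < 2 * g))).const_mul 3
      simpa using this
    refine squeeze_zero hq0 (fun n => ?_) hlim
    have h1 : (N n : ℝ) ≤ Real.exp (n * R) := by
      have h2 := Nat.ceil_lt_add_one (Real.exp_pos (n * R)).le
      rw [← hNpos n] at h2
      push_cast at h2
      linarith
    have h3 : (k n : ℝ) + 1 ≤ 3 * Real.exp (n * (t + g)) := by
      have h2 := Nat.ceil_lt_add_one (Real.exp_pos (n * (t + g))).le
      have h4 : 1 ≤ Real.exp (n * (t + g)) := Real.one_le_exp (by positivity)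
      simp only [k]
      linarith
    calc q n ≤ Real.exp (n * R) * (3 * Real.exp (n * (t + g)) * Real.exp (-(n * β))) := by
          simp only [q]
          gcongr
      _ = 3 * Real.exp (-(n * (2 * g))) := by
          rw [show -((n : ℝ) * (2 * g)) = n * R + (n * (t + g) + -(n * β)) by
            rw [hg, ht]; ring, Real.exp_add, Real.exp_add]
          ring
  let e : ℕ → ℝ := fun n => ((B n).toReal + d n) + d n + q n + 1 / ((n : ℝ) + 1)
  have he0 : ∀ n, 0 < e n := by
    intro n
    have h1 := hd0 n
    have h2 := hq0 n
    have h3 : 0 ≤ (B n).toReal := ENNReal.toReal_nonneg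
    have h4 : 0 < 1 / ((n : ℝ) + 1) := by positivity
    simp only [e]
    linarith
  have he : Tendsto e atTop (𝓝 0) := by
    have := (((((ENNReal.tendsto_toReal ENNReal.zero_ne_top).comp hB).add hd).add hd).add hq).add
      tendsto_one_div_add_atTop_nhds_zero_nat
    simp only [add_zero, ENNReal.toReal_zero] at this
    exact this
  have hse : Tendsto (fun n => √(e n)) atTop (𝓝 0) := by
    simpa using he.sqrt
  have hcode : ∀ n, ∃ c : Code M n, c.size = N n + 1 ∧ (1 ≤ n →
      n / √(e n) * c.errorProb + c.expDistortion ≤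
        n * √(e n) + (p.expDistortion n + n * Dmax * d n)) := by
    intro n
    have hδ : ENNReal.ofReal (d n) = ENNReal.ofReal ((1 - 1 / Real.exp (n * t)) ^ (k n + 1)) +
        p.encLaw n {ω | ((n * t : ℝ) : EReal) < logRatio (p.encLaw n) (p.encLawIndep n) ω} := by
      simp only [d]
      rw [ENNReal.ofReal_add (hr0 n) ENNReal.toReal_nonneg, ENNReal.ofReal_toReal]
      exact measure_ne_top _ _
    have hb' : ∃ b : ℝ, (1 ≤ n → b = n * Dmax) ∧ ∀ x y, M.dist n x y ≤ b := by
      rcases Nat.eq_zero_or_pos n with rfl | hn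
      · exact ⟨M.dist 0 (fun i => i.elim0) (fun i => i.elim0), by simp, fun x y => le_of_eq (by
          congr 1 <;> exact Subsingleton.elim _ _)⟩
      · exact ⟨n * Dmax, fun _ => rfl, hb n hn⟩
    obtain ⟨b, hbn, hb'⟩ := hb'
    obtain ⟨c, hc, hle⟩ := p.exists_code_of_thresholds n (k n) (N n)
      (by positivity : (0 : ℝ) ≤ n * t) (n * β) hb' (ENNReal.ofReal (n / √(e n))) hδ
    refine ⟨c, hc, fun hn => ?_⟩
    have hsn : 0 < √(e n) := Real.sqrt_pos.2 (he0 n)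
    have hη : (B n + ENNReal.ofReal (d n)) + ENNReal.ofReal (d n) +
        N n * ((k n + 1) * ENNReal.ofReal (Real.exp (-(n * β)))) ≤ ENNReal.ofReal (e n) := by
      have h1 : (N n : ℝ≥0∞) * ((k n + 1) * ENNReal.ofReal (Real.exp (-(n * β)))) =
          ENNReal.ofReal (q n) := by
        simp only [q]
        rw [ENNReal.ofReal_mul (by positivity), ENNReal.ofReal_mul (by positivity),
          ENNReal.ofReal_natCast, ENNReal.ofReal_add (by positivity) zero_le_one,
          ENNReal.ofReal_natCast, ENNReal.ofReal_one]
      have h2 : B n = ENNReal.ofReal (B n).toReal :=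
        (ENNReal.ofReal_toReal (measure_ne_top _ _)).symm
      rw [h1, h2, ← ENNReal.ofReal_add ENNReal.toReal_nonneg (hd0 n), ← ENNReal.ofReal_add
        (add_nonneg ENNReal.toReal_nonneg (hd0 n)) (hd0 n), ← ENNReal.ofReal_add
        (add_nonneg (add_nonneg ENNReal.toReal_nonneg (hd0 n)) (hd0 n)) (hq0 n)]
      refine ENNReal.ofReal_le_ofReal ?_
      have : 0 < 1 / ((n : ℝ) + 1) := by positivity
      simp only [e]
      linarith
    have hEp := p.expDistortion_nonneg n
    have hP := Code.errorProb_nonneg c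
    have hE := Code.expDistortion_nonneg c
    have hdn := hd0 n
    have hen := he0 n
    have hreal : ENNReal.ofReal (n / √(e n) * c.errorProb + c.expDistortion) ≤
        ENNReal.ofReal (n / √(e n) * e n + (p.expDistortion n + n * Dmax * d n)) := by
      rw [ENNReal.ofReal_add (by positivity) hE, ENNReal.ofReal_mul (by positivity),
        ENNReal.ofReal_add (by positivity) (by positivity),
        ENNReal.ofReal_mul (p := n / √(e n)) (by positivity),
        ENNReal.ofReal_add hEp (by positivity), ENNReal.ofReal_mul (p := n * Dmax) (by positivity)]
      refine hle.trans ?_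
      rw [hbn hn]
      gcongr
    have hfin := (ENNReal.ofReal_le_ofReal_iff (by positivity)).1 hreal
    have hsq : n / √(e n) * e n = n * √(e n) := by
      nth_rewrite 2 [← Real.mul_self_sqrt hen.le]
      field_simp
    rwa [hsq] at hfin
  choose c hc hle using hcode
  intro ε hε
  refine ⟨c, ?_, ?_, ?_⟩
  · refine le_liminf_coe_iff.2 fun e' he' => ?_
    filter_upwards [eventually_ge_atTop 1] with n hn
    have hn' : (0 : ℝ) < n := by exact_mod_cast hn
    have h1 : Real.exp (n * R) ≤ ((c n).size : ℝ) := by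
      rw [hc n, hNpos n]
      exact Nat.le_ceil _
    have h2 : n * R ≤ Real.log (c n).size := by
      rw [Real.le_log_iff_exp_le (lt_of_lt_of_le (Real.exp_pos _) h1)]
      exact h1
    have h3 : R ≤ 1 / (n : ℝ) * Real.log (c n).size := by
      rw [one_div, le_inv_mul_iff₀ hn']
      exact h2
    linarith
  · refine limsup_coe_le_iff.2 fun e' he' => ?_
    have hlim : Tendsto (fun n => √(e n) * (√(e n) + Dmax + Dmax * d n)) atTop (𝓝 0) := by
      have := hse.mul ((hse.add_const Dmax).add (hd.const_mul Dmax))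
      simpa using this
    filter_upwards [eventually_ge_atTop 1, hlim.eventually_lt_const (by linarith : 0 < ε + e')]
      with n hn hlt
    refine lt_of_le_of_lt ?_ hlt
    have hn' : (0 : ℝ) < n := by exact_mod_cast hn
    have hsn : 0 < √(e n) := Real.sqrt_pos.2 (he0 n)
    have h1 := hle n hn
    have h2 := Code.expDistortion_nonneg (c n)
    have h3 := p.expDistortion_le (hb n hn)
    have h4 : n / √(e n) * (c n).errorProb ≤ n * (√(e n) + Dmax + Dmax * d n) := by
      calc n / √(e n) * (c n).errorProb ≤ n * √(e n) + (n * Dmax + n * Dmax * d n) := by linarith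
        _ = _ := by ring
    rw [div_mul_eq_mul_div, div_le_iff₀ hsn, mul_assoc] at h4
    have h5 := le_of_mul_le_mul_left h4 hn'
    linarith
  · refine limsup_coe_le_iff.2 fun e' he' => ?_
    have hlim : Tendsto (fun n => √(e n) + Dmax * d n) atTop (𝓝 0) := by
      have := hse.add (hd.const_mul Dmax)
      simpa using this
    filter_upwards [eventually_ge_atTop 1, hlim.eventually_lt_const (by linarith : 0 < e' / 2),
      limsup_coe_le_iff.1 hD (e' / 2) (by linarith)] with n hn hlt hDn
    have hn' : (0 : ℝ) < n := by exact_mod_cast hn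
    have hsn : 0 < √(e n) := Real.sqrt_pos.2 (he0 n)
    have h1 := hle n hn
    have h2 : 0 ≤ n / √(e n) * (c n).errorProb :=
      mul_nonneg (by positivity) (Code.errorProb_nonneg _)
    have h3 : 1 / (n : ℝ) * (c n).expDistortion ≤
        1 / (n : ℝ) * p.expDistortion n + (√(e n) + Dmax * d n) := by
      calc 1 / (n : ℝ) * (c n).expDistortion
          ≤ 1 / (n : ℝ) * (n * √(e n) + (p.expDistortion n + n * Dmax * d n)) := by
            gcongr
            linarith
        _ = _ := by
            field_simp
            ring
    linarith

end AuxProcess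

/-! ### The process induced by a sequence of codes -/

/-- If `φ` is uniformly distributed on `L` values and is guessed by `ψ`, then the likelihood
ratio of the joint law with respect to the product of its marginals is rarely below `L`, unless the
guess is often wrong. -/
lemma measure_logRatio_le_le {B C : Type*} [MeasurableSpace B] [MeasurableSpace C]
    (P : Measure (B × C)) [IsProbabilityMeasure P] {L : ℕ} {φ : B → Fin L}
    {ψ : C → Fin L} (hψ : Measurable ψ) (hunif : ∀ m, P.fst (φ ⁻¹' {m}) = (L : ℝ≥0∞)⁻¹) (t : ℝ) :
    P {ω | logRatio P (P.fst.prod P.snd) ω ≤ t} ≤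
      P {ω | φ ω.1 ≠ ψ ω.2} + ENNReal.ofReal (Real.exp t) * (L : ℝ≥0∞)⁻¹ := by
  have hQ : (P.fst.prod P.snd) {ω | φ ω.1 = ψ ω.2} ≤ (L : ℝ≥0∞)⁻¹ := by
    calc (P.fst.prod P.snd) {ω | φ ω.1 = ψ ω.2}
        ≤ (P.fst.prod P.snd) (⋃ m, (φ ⁻¹' {m}) ×ˢ (ψ ⁻¹' {m})) := by
          refine measure_mono fun ω hω => Set.mem_iUnion.2 ⟨φ ω.1, rfl, ?_⟩
          exact (show φ ω.1 = ψ ω.2 from hω).symm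
      _ ≤ ∑ m, (P.fst.prod P.snd) ((φ ⁻¹' {m}) ×ˢ (ψ ⁻¹' {m})) := measure_iUnion_fintype_le _ _
      _ = (L : ℝ≥0∞)⁻¹ * ∑ m, P.snd (ψ ⁻¹' {m}) := by
          rw [Finset.mul_sum]
          refine Finset.sum_congr rfl fun m _ => ?_
          rw [Measure.prod_prod, hunif]
      _ = (L : ℝ≥0∞)⁻¹ := by
          rw [sum_measure_preimage_singleton _ fun m _ => hψ (measurableSet_singleton m)]
          simp
  calc P {ω | logRatio P (P.fst.prod P.snd) ω ≤ t}
      ≤ P ({ω | φ ω.1 ≠ ψ ω.2} ∪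
          {ω | φ ω.1 = ψ ω.2} ∩ {ω | logRatio P (P.fst.prod P.snd) ω ≤ t}) := by
        refine measure_mono fun ω hω => ?_
        by_cases h : φ ω.1 = ψ ω.2
        · exact Or.inr ⟨h, hω⟩
        · exact Or.inl h
    _ ≤ P {ω | φ ω.1 ≠ ψ ω.2} + ENNReal.ofReal (Real.exp t) * (L : ℝ≥0∞)⁻¹ := by
        refine (measure_union_le _ _).trans ?_
        gcongr
        refine (measure_inter_logRatio_le _ _ _ _).trans ?_
        gcongr

namespace Code

variable {M : Model 𝒜 Se S Sd 𝒳 𝒴 𝒵 Sh} {n : ℕ} (c : Code M n)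

/-- The joint law of the action sequence and of the uniformly distributed message, the latter
written as a constant sequence of natural numbers. -/
noncomputable def msgLaw : Measure (Seq 𝒜 n × Seq ℕ n) :=
  (c.size : ℝ≥0∞)⁻¹ • ∑ m, Measure.dirac ((c.actEnc m : Seq 𝒜 n), fun _ => (m : ℕ))

/-- The message written as the first entry of a sequence of natural numbers. The reduction modulo
the number of messages and the value at block length `0` are irrelevant conventions. -/
def toMsg (u : Seq ℕ n) : Fin c.size :=
  ⟨(if h : 0 < n then u ⟨0, h⟩ else 0) % c.size, Nat.mod_lt _ c.size_pos⟩

lemma toMsg_const (hn : 1 ≤ n) (m : Fin c.size) : c.toMsg (fun _ => (m : ℕ)) = m := by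
  have h : 0 < n := hn
  simp only [toMsg, h, dif_pos, Nat.mod_eq_of_lt m.2]

lemma measurable_toMsg : Measurable c.toMsg := measurable_of_countable _

instance : IsProbabilityMeasure c.msgLaw := by
  refine ⟨?_⟩
  have h : (c.size : ℝ≥0∞) ≠ 0 := by exact_mod_cast c.size_pos.ne'
  simp [msgLaw, ENNReal.inv_mul_cancel h]

lemma lintegral_msgLaw {f : Seq 𝒜 n × Seq ℕ n → ℝ≥0∞} (hf : Measurable f) :
    ∫⁻ x, f x ∂c.msgLaw = (c.size : ℝ≥0∞)⁻¹ * ∑ m, f (c.actEnc m, fun _ => (m : ℕ)) := by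
  rw [msgLaw, lintegral_smul_measure, lintegral_finsetSum_measure, smul_eq_mul]
  congr 1
  exact Finset.sum_congr rfl fun m _ => lintegral_dirac' _ hf

end Code

section CodeProcess

variable {M : Model 𝒜 Se S Sd 𝒳 𝒴 𝒵 Sh}

/-- The process induced by a sequence of codes: the auxiliary variable is the message, whose law
given the action sequence does not depend on the state. -/
noncomputable def codeProcess (c : ∀ n, Code M n) : AuxProcess M ℕ where
  act n := (c n).msgLaw.fst
  act_prob _ := inferInstance
  aux n := (c n).msgLaw.condKernel.comap Prod.fst measurable_fst
  aux_markov _ := inferInstance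
  inp n := Kernel.deterministic (fun x => (c n).enc ((c n).toMsg x.1) x.2) <|
    measurable_from_prod_countable_right fun u =>
      (show Measurable fun y => (c n).enc ((c n).toMsg u) y from (c n).enc_measurable _)
  inp_markov _ := inferInstance
  est n := (c n).est
  est_measurable n := (c n).est_measurable

variable (c : ∀ n, Code M n)

lemma supRateCond_codeProcess_nonpos : (codeProcess c).supRateCond ≤ 0 := by
  have h : (codeProcess c).encLawIndep = (codeProcess c).encLaw := by
    funext n
    have h1 : (M.state n).fst ⊗ₖ (codeProcess c).aux n =
        (M.state n).fst ×ₖ (c n).msgLaw.condKernel :=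
      (prod_eq_compProd_comap (M.state n).fst (c n).msgLaw.condKernel).symm
    rw [AuxProcess.encLawIndep, AuxProcess.encLaw, h1, Kernel.snd_prod]
  have h2 : (codeProcess c).supRateCond = pLimsup (codeProcess c).encLaw fun n ω =>
    ((1 / (n : ℝ) : ℝ) : EReal) *
      logRatio ((codeProcess c).encLaw n) ((codeProcess c).encLawIndep n) ω := rfl
  rw [h2, h]
  exact pLimsup_logRatio_self_nonpos _

/-- The law of the induced process is that of the codes, averaged over the messages. At block length
`0` this can fail, since the message is not encoded there. -/
lemma lintegral_jointLaw_codeProcess {n : ℕ} (hn : 1 ≤ n)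
    {f : (((Seq 𝒜 n × (Seq Se n × Seq S n × Seq Sd n)) × Seq ℕ n) × Seq 𝒳 n) ×
      (Seq 𝒴 n × Seq 𝒵 n) → ℝ≥0∞} (hf : Measurable f) :
    ∫⁻ ω, f ω ∂((codeProcess c).jointLaw n) = ((c n).size : ℝ≥0∞)⁻¹ * ∑ m,
      ∫⁻ o, f ((((((c n).actEnc m : Seq 𝒜 n), o.1), fun _ => (m : ℕ)), (c n).enc m o.1.1), o.2)
        ∂((c n).outLaw m) := by
  have henc : Measurable fun x : Seq ℕ n × Seq Se n => (c n).enc ((c n).toMsg x.1) x.2 :=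
    measurable_from_prod_countable_right fun u =>
      (show Measurable fun y => (c n).enc ((c n).toMsg u) y from (c n).enc_measurable _)
  -- The conditional mean of `f` given the action sequence, the states and the message.
  let h : (Seq 𝒜 n × (Seq Se n × Seq S n × Seq Sd n)) × Seq ℕ n → ℝ≥0∞ := fun r =>
    ∫⁻ yz, f ((r, (c n).enc ((c n).toMsg r.2) r.1.2.1), yz)
      ∂(M.channel n ((c n).enc ((c n).toMsg r.2) r.1.2.1, r.1.2.2.1))
  have hx : Measurable fun r : (Seq 𝒜 n × (Seq Se n × Seq S n × Seq Sd n)) × Seq ℕ n =>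
      (c n).enc ((c n).toMsg r.2) r.1.2.1 :=
    henc.comp (f := fun r : (Seq 𝒜 n × (Seq Se n × Seq S n × Seq Sd n)) × Seq ℕ n =>
      (r.2, r.1.2.1)) (by fun_prop)
  have hg := hf.lintegral_kernel_prod_right' (κ := (M.channel n).comap
      (fun ω : ((Seq 𝒜 n × (Seq Se n × Seq S n × Seq Sd n)) × Seq ℕ n) × Seq 𝒳 n =>
        (ω.2, ω.1.1.2.2.1)) (by fun_prop))
  have hh : Measurable h := hg.comp (measurable_id.prodMk hx)
  have hH : Measurable fun r : Seq 𝒜 n × Seq ℕ n =>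
      ∫⁻ w, h ((r.1, w), r.2) ∂(M.state n r.1) := by
    have := Measurable.lintegral_kernel_prod_right' (κ := (M.state n).comap
      (Prod.fst : Seq 𝒜 n × Seq ℕ n → Seq 𝒜 n) measurable_fst)
      (f := fun r : (Seq 𝒜 n × Seq ℕ n) × (Seq Se n × Seq S n × Seq Sd n) =>
        h ((r.1.1, r.2), r.1.2)) (by fun_prop)
    exact this
  calc ∫⁻ ω, f ω ∂((codeProcess c).jointLaw n)
      = ∫⁻ r, h r ∂(((codeProcess c).act n ⊗ₘ M.state n) ⊗ₘ ((codeProcess c).aux n).comap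
          (fun x : Seq 𝒜 n × (Seq Se n × Seq S n × Seq Sd n) => (x.1, x.2.1)) (by fun_prop)) := by
        rw [AuxProcess.jointLaw, Measure.lintegral_compProd hf, Measure.lintegral_compProd hg]
        refine lintegral_congr fun r => ?_
        have hd : (codeProcess c).inp n (r.2, r.1.2.1) =
            Measure.dirac ((c n).enc ((c n).toMsg r.2) r.1.2.1) :=
          Kernel.deterministic_apply henc _
        rw [Kernel.comap_apply, hd]
        exact lintegral_dirac' _ (hg.comp measurable_prodMk_left)
    _ = ∫⁻ a, ∫⁻ w, ∫⁻ u, h ((a, w), u) ∂((c n).msgLaw.condKernel a) ∂(M.state n a)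
          ∂(c n).msgLaw.fst := by
        rw [Measure.lintegral_compProd hh,
          Measure.lintegral_compProd hh.lintegral_kernel_prod_right']
        rfl
    _ = ∫⁻ a, ∫⁻ u, ∫⁻ w, h ((a, w), u) ∂(M.state n a) ∂((c n).msgLaw.condKernel a)
          ∂(c n).msgLaw.fst := by
        refine lintegral_congr fun a => lintegral_lintegral_swap ?_
        exact (hh.comp (by fun_prop : Measurable
          fun z : (Seq Se n × Seq S n × Seq Sd n) × Seq ℕ n => ((a, z.1), z.2))).aemeasurable
    _ = ∫⁻ r, ∫⁻ w, h ((r.1, w), r.2) ∂(M.state n r.1) ∂(c n).msgLaw := by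
        conv_rhs => rw [← (c n).msgLaw.disintegrate (c n).msgLaw.condKernel]
        rw [Measure.lintegral_compProd hH]
    _ = _ := by
        rw [(c n).lintegral_msgLaw hH]
        congr 1
        refine Finset.sum_congr rfl fun m _ => ?_
        have hm := (c n).enc_measurable m
        rw [Code.outLaw, Measure.lintegral_compProd (by fun_prop)]
        simp only [h, (c n).toMsg_const hn, Kernel.comap_apply]

lemma jointLaw_codeProcess_apply {n : ℕ} (hn : 1 ≤ n)
    {E : Set ((((Seq 𝒜 n × (Seq Se n × Seq S n × Seq Sd n)) × Seq ℕ n) × Seq 𝒳 n) ×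
      (Seq 𝒴 n × Seq 𝒵 n))} (hE : MeasurableSet E) :
    (codeProcess c).jointLaw n E = ((c n).size : ℝ≥0∞)⁻¹ * ∑ m, (c n).outLaw m
      {o | ((((((c n).actEnc m : Seq 𝒜 n), o.1), fun _ => (m : ℕ)), (c n).enc m o.1.1), o.2)
        ∈ E} := by
  rw [← lintegral_indicator_one hE,
    lintegral_jointLaw_codeProcess c hn (measurable_one.indicator hE)]
  congr 1
  refine Finset.sum_congr rfl fun m _ => ?_
  have hm := (c n).enc_measurable m
  have h := (by fun_prop : Measurable fun o : (Seq Se n × Seq S n × Seq Sd n) ×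
    (Seq 𝒴 n × Seq 𝒵 n) =>
      ((((((c n).actEnc m : Seq 𝒜 n), o.1), (fun _ => (m : ℕ) : Seq ℕ n)), (c n).enc m o.1.1),
        o.2)) hE
  exact lintegral_indicator_one h

lemma jointLaw_codeProcess_error {n : ℕ} (hn : 1 ≤ n) :
    (codeProcess c).jointLaw n
      {ω | (c n).toMsg ω.1.1.2 ≠ (c n).dec (ω.2.1, ω.1.1.1.2.2.2)} =
        ENNReal.ofReal (c n).errorProb := by
  have h1 := (c n).measurable_toMsg
  have h2 := (c n).dec_measurable
  rw [jointLaw_codeProcess_apply c hn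
    (E := {ω | (c n).toMsg ω.1.1.2 ≠ (c n).dec (ω.2.1, ω.1.1.1.2.2.2)})
    (measurableSet_eq_fun (by fun_prop) (by fun_prop)).compl, Code.errorProb,
    ofReal_average (c n).size_pos fun _ => measureReal_nonneg]
  congr 1
  refine Finset.sum_congr rfl fun m _ => ?_
  rw [ofReal_measureReal]
  congr 1
  ext o
  change (c n).toMsg (fun _ => (m : ℕ)) ≠ _ ↔ _
  rw [(c n).toMsg_const hn]
  exact ne_comm

lemma jointLaw_codeProcess_toMsg {n : ℕ} (hn : 1 ≤ n) (m : Fin (c n).size) :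
    (codeProcess c).jointLaw n {ω | (c n).toMsg ω.1.1.2 = m} = ((c n).size : ℝ≥0∞)⁻¹ := by
  have h1 := (c n).measurable_toMsg
  rw [jointLaw_codeProcess_apply c hn (measurableSet_eq_fun (by fun_prop) measurable_const),
    Finset.sum_eq_single m]
  · simp [(c n).toMsg_const hn]
  · intro m' _ hm'
    simp [(c n).toMsg_const hn, hm']
  · simp

lemma expDistortion_codeProcess {n : ℕ} (hn : 1 ≤ n) {b : ℝ} (hb : ∀ x y, M.dist n x y ≤ b) :
    (codeProcess c).expDistortion n = (c n).expDistortion := by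
  have h1 := (c n).est_measurable
  have h2 := M.dist_measurable n
  have h3 : Measurable fun ω : (((Seq 𝒜 n × (Seq Se n × Seq S n × Seq Sd n)) × Seq ℕ n) ×
      Seq 𝒳 n) × (Seq 𝒴 n × Seq 𝒵 n) =>
      M.dist n ω.1.1.1.2.2.1 ((c n).est (ω.1.2, ω.1.1.1.1, ω.1.1.1.2.1, ω.2.2)) :=
    h2.comp (f := fun ω : (((Seq 𝒜 n × (Seq Se n × Seq S n × Seq Sd n)) × Seq ℕ n) ×
      Seq 𝒳 n) × (Seq 𝒴 n × Seq 𝒵 n) =>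
      (ω.1.1.1.2.2.1, (c n).est (ω.1.2, ω.1.1.1.1, ω.1.1.1.2.1, ω.2.2))) (by fun_prop)
  rw [← ENNReal.ofReal_eq_ofReal_iff ((codeProcess c).expDistortion_nonneg n)
    (Code.expDistortion_nonneg _), Code.expDistortion,
    ofReal_average (c n).size_pos
      fun _ => integral_nonneg fun _ => M.dist_nonneg _ _ _,
    AuxProcess.expDistortion]
  change ENNReal.ofReal (∫ ω, M.dist n ω.1.1.1.2.2.1
    ((c n).est (ω.1.2, ω.1.1.1.1, ω.1.1.1.2.1, ω.2.2)) ∂(codeProcess c).jointLaw n) = _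
  rw [ofReal_integral_eq_lintegral_ofReal
      (.of_bound h3.aestronglyMeasurable b (ae_of_all _ fun ω => by
        rw [Real.norm_of_nonneg (M.dist_nonneg _ _ _)]; exact hb _ _))
      (ae_of_all _ fun _ => M.dist_nonneg _ _ _)]
  refine (lintegral_jointLaw_codeProcess c hn h3.ennreal_ofReal).trans ?_
  congr 1
  refine Finset.sum_congr rfl fun m _ => ?_
  have hm := (c n).enc_measurable m
  have h4 : Measurable fun ω : (Seq Se n × Seq S n × Seq Sd n) × (Seq 𝒴 n × Seq 𝒵 n) =>
      M.dist n ω.1.2.1 ((c n).est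
        ((c n).enc m ω.1.1, ((c n).actEnc m : Seq 𝒜 n), ω.1.1, ω.2.2)) :=
    h2.comp (f := fun ω : (Seq Se n × Seq S n × Seq Sd n) × (Seq 𝒴 n × Seq 𝒵 n) =>
      (ω.1.2.1, (c n).est ((c n).enc m ω.1.1, ((c n).actEnc m : Seq 𝒜 n), ω.1.1, ω.2.2)))
      (by fun_prop)
  rw [ofReal_integral_eq_lintegral_ofReal
      (.of_bound h4.aestronglyMeasurable b (ae_of_all _ fun ω => by
        rw [Real.norm_of_nonneg (M.dist_nonneg _ _ _)]; exact hb _ _))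
      (ae_of_all _ fun _ => M.dist_nonneg _ _ _)]

/-- The message and the channel output have an information rate at least the rate of the codes, if
the error probability vanishes. -/
lemma le_infRateAux_codeProcess {R : ℝ}
    (hR : ∀ e : ℝ, 0 < e → ∀ᶠ n : ℕ in atTop, R - e < 1 / (n : ℝ) * Real.log (c n).size)
    (hP : Tendsto (fun n => (c n).errorProb) atTop (𝓝 0)) :
    (R : EReal) ≤ (codeProcess c).infRateAux := by
  refine EReal.ge_of_forall_gt_iff_ge.1 fun r hr => ?_
  have hr' : r < R := by exact_mod_cast hr
  refine le_sSup ?_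
  have he : 0 < (R - r) / 2 := by linarith
  -- Half of the gap between `r` and `R` is given up for the rate, the other half for the exponent.
  have hlim : Tendsto (fun n : ℕ => ENNReal.ofReal (c n).errorProb +
      ENNReal.ofReal (Real.exp (-(n * ((R - r) / 2))))) atTop (𝓝 0) := by
    have := (ENNReal.tendsto_ofReal hP).add (tendsto_ofReal_exp_neg_mul he)
    simpa using this
  refine tendsto_of_tendsto_of_tendsto_of_le_of_le' tendsto_const_nhds hlim
    (Eventually.of_forall fun _ => zero_le) ?_
  filter_upwards [hR _ he, eventually_ge_atTop 1] with n hrate hn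
  have hn' : (0 : ℝ) < n := by exact_mod_cast hn
  have hm : Measurable fun ω : (((Seq 𝒜 n × (Seq Se n × Seq S n × Seq Sd n)) × Seq ℕ n) ×
      Seq 𝒳 n) × (Seq 𝒴 n × Seq 𝒵 n) => (ω.1.1.2, (ω.2.1, ω.1.1.1.2.2.2)) := by fun_prop
  set P := ((codeProcess c).jointLaw n).map fun ω => (ω.1.1.2, (ω.2.1, ω.1.1.1.2.2.2))
  have : IsProbabilityMeasure P := Measure.isProbabilityMeasure_map hm.aemeasurable
  have h1 := (c n).measurable_toMsg
  have h2 := (c n).dec_measurable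
  have hunif : ∀ m, P.fst ((c n).toMsg ⁻¹' {m}) = ((c n).size : ℝ≥0∞)⁻¹ := by
    intro m
    rw [Measure.fst_apply (h1 (measurableSet_singleton m)), Measure.map_apply hm
      (measurable_fst (h1 (measurableSet_singleton m)))]
    exact jointLaw_codeProcess_toMsg c hn m
  have herr : P {ω | (c n).toMsg ω.1 ≠ (c n).dec ω.2} = ENNReal.ofReal (c n).errorProb := by
    rw [Measure.map_apply hm
      (s := {ω | (c n).toMsg ω.1 ≠ (c n).dec ω.2})
      (measurableSet_eq_fun (by fun_prop) (by fun_prop)).compl]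
    exact jointLaw_codeProcess_error c hn
  calc P {ω | ((1 / (n : ℝ) : ℝ) : EReal) * logRatio P (P.fst.prod P.snd) ω < r}
      ≤ P {ω | logRatio P (P.fst.prod P.snd) ω ≤ ((n * r : ℝ) : EReal)} :=
        measure_mono fun ω hω => (one_div_mul_le_coe_iff hn _ _).1 (le_of_lt hω)
    _ ≤ _ := measure_logRatio_le_le P h2 hunif (n * r)
    _ ≤ _ := by
        rw [herr]
        gcongr
        have hL : (0 : ℝ) < (c n).size := by exact_mod_cast (c n).size_pos
        rw [← ENNReal.ofReal_natCast, ← ENNReal.ofReal_inv_of_pos hL,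
          ← ENNReal.ofReal_mul (Real.exp_pos _).le]
        refine ENNReal.ofReal_le_ofReal ?_
        rw [← Real.exp_log hL, ← Real.exp_neg, ← Real.exp_add]
        refine Real.exp_le_exp.2 ?_
        rw [one_div, lt_inv_mul_iff₀ hn'] at hrate
        linarith

end CodeProcess

/-! ### The general formula -/

/-- A diagonal argument: if, for every `k`, some sequence eventually has the property `Q k`, where
these properties become stronger as `k` grows, then one sequence eventually has all of them. -/
lemma exists_forall_eventually {X : ℕ → Type*} {Q : ℕ → ∀ n, X n → Prop}
    (hQ : ∀ n x k k', k ≤ k' → Q k' n x → Q k n x)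
    (h : ∀ k, ∃ c : ∀ n, X n, ∀ᶠ n in atTop, Q k n (c n)) :
    ∃ c : ∀ n, X n, ∀ k, ∀ᶠ n in atTop, Q k n (c n) := by
  classical
  choose c hc using h
  refine ⟨fun n => c (Nat.findGreatest (fun k => Q k n (c k n)) n) n, fun k => ?_⟩
  filter_upwards [hc k, eventually_ge_atTop k] with n hn hkn
  exact hQ n _ _ _ (Nat.le_findGreatest hkn hn)
    (Nat.findGreatest_spec (P := fun k => Q k n (c k n)) hkn hn)

variable {M : Model 𝒜 Se S Sd 𝒳 𝒴 𝒵 Sh}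

/-- An achievable pair is achieved by a sequence of codes with vanishing error probability. -/
lemma Model.AvgAchievable.exists_codes {R D : ℝ} (h : M.AvgAchievable R D) :
    ∃ c : ∀ n, Code M n,
      (∀ e : ℝ, 0 < e → ∀ᶠ n : ℕ in atTop, R - e < 1 / (n : ℝ) * Real.log (c n).size) ∧
      Tendsto (fun n => (c n).errorProb) atTop (𝓝 0) ∧
      ∀ e : ℝ, 0 < e → ∀ᶠ n : ℕ in atTop, 1 / (n : ℝ) * (c n).expDistortion < D + e := by
  obtain ⟨c, hc⟩ := exists_forall_eventually (X := Code M)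
    (Q := fun k n c => R - 1 / ((k : ℝ) + 1) < 1 / (n : ℝ) * Real.log c.size ∧
      c.errorProb < 2 * (1 / ((k : ℝ) + 1)) ∧
      1 / (n : ℝ) * c.expDistortion < D + 1 / ((k : ℝ) + 1)) (by
        intro n x k k' hk hx
        have := Nat.one_div_le_one_div (α := ℝ) hk
        exact ⟨by linarith [hx.1], by linarith [hx.2.1], by linarith [hx.2.2]⟩) (by
        intro k
        have hk : (0 : ℝ) < 1 / ((k : ℝ) + 1) := Nat.one_div_pos_of_nat
        obtain ⟨c, h1, h2, h3⟩ := h _ hk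
        refine ⟨c, ?_⟩
        filter_upwards [le_liminf_coe_iff.1 h1 _ hk, limsup_coe_le_iff.1 h2 _ hk,
          limsup_coe_le_iff.1 h3 _ hk] with n hn1 hn2 hn3
        exact ⟨hn1, by linarith, hn3⟩)
  refine ⟨c, fun e he => ?_, ?_, fun e he => ?_⟩
  · obtain ⟨k, hk⟩ := exists_nat_one_div_lt he
    filter_upwards [hc k] with n hn
    linarith [hn.1]
  · rw [Metric.tendsto_atTop']
    intro e he
    obtain ⟨k, hk⟩ := exists_nat_one_div_lt (half_pos he)
    obtain ⟨N, hN⟩ := eventually_atTop.1 (hc k)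
    refine ⟨N, fun n hn => ?_⟩
    rw [Real.dist_0_eq_abs, abs_of_nonneg (Code.errorProb_nonneg _)]
    linarith [(hN n hn.le).2.1]
  · obtain ⟨k, hk⟩ := exists_nat_one_div_lt he
    filter_upwards [hc k] with n hn
    linarith [hn.2.2]

/-- **Converse.** An achievable rate is at most the difference of the two spectral rates of some
process that meets the distortion constraint. -/
theorem Model.AvgAchievable.exists_auxProcess {R D : ℝ} (h : M.AvgAchievable R D)
    (hM : M.UniformlyBounded) :
    ∃ p : AuxProcess M ℕ, p.MeetsDistortion D ∧ (R : EReal) ≤ p.infRateAux - p.supRateCond := by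
  obtain ⟨c, hR, hP, hD⟩ := h.exists_codes
  obtain ⟨Dmax, -, hdist⟩ := hM
  refine ⟨codeProcess c, limsup_coe_le_iff.2 fun e he => ?_, ?_⟩
  · filter_upwards [hD e he, eventually_ge_atTop 1] with n hn hn1
    have hn' : (0 : ℝ) < n := by exact_mod_cast hn1
    rwa [expDistortion_codeProcess c hn1 (b := n * Dmax) fun x y => by
      have := hdist n hn1 x y
      rwa [one_div, inv_mul_le_iff₀ hn'] at this]
  · have := EReal.sub_le_sub (le_infRateAux_codeProcess c hR hP) (supRateCond_codeProcess_nonpos c)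
    simpa using this

end ISAC

/-- General formula for the capacity-distortion function under an average distortion constraint.
Differences of information rates are taken in the extended reals, where `⊤ - ⊤ = ⊥`: a process
whose subtracted rate is infinite does not contribute to the supremum. -/
theorem theorem1 {𝒜 Se S Sd 𝒳 𝒴 𝒵 Sh : Type*} [MeasurableSpace 𝒜] [MeasurableSpace Se]
    [MeasurableSpace S] [MeasurableSpace Sd] [MeasurableSpace 𝒳] [StandardBorelSpace 𝒳]
    [MeasurableSpace 𝒴] [MeasurableSpace 𝒵] [MeasurableSpace Sh]
    (M : ISAC.Model 𝒜 Se S Sd 𝒳 𝒴 𝒵 Sh) (hM : M.UniformlyBounded) (D : ℝ) :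
    M.avgCapacity D =
      (⨆ (𝒰 : Type) (_ : MeasurableSpace 𝒰) (p : ISAC.AuxProcess M 𝒰) (_ : p.MeetsDistortion D),
        p.infRateActAux - p.supRateCond) ∧
    M.avgCapacity D =
      (⨆ (𝒰 : Type) (_ : MeasurableSpace 𝒰) (p : ISAC.AuxProcess M 𝒰) (_ : p.MeetsDistortion D),
        p.infRateAux - p.supRateCond) := by
  have h1 : M.avgCapacity D ≤
      ⨆ (𝒰 : Type) (_ : MeasurableSpace 𝒰) (p : ISAC.AuxProcess M 𝒰) (_ : p.MeetsDistortion D),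
        p.infRateAux - p.supRateCond := by
    refine sSup_le ?_
    rintro _ ⟨R, hR, rfl⟩
    obtain ⟨p, hp, hle⟩ := hR.exists_auxProcess hM
    exact hle.trans (le_iSup₂_of_le ℕ inferInstance (le_iSup₂_of_le p hp le_rfl))
  have h2 : (⨆ (𝒰 : Type) (_ : MeasurableSpace 𝒰) (p : ISAC.AuxProcess M 𝒰)
      (_ : p.MeetsDistortion D), p.infRateAux - p.supRateCond) ≤
      ⨆ (𝒰 : Type) (_ : MeasurableSpace 𝒰) (p : ISAC.AuxProcess M 𝒰) (_ : p.MeetsDistortion D),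
        p.infRateActAux - p.supRateCond :=
    iSup₂_mono fun _ _ => iSup₂_mono fun p _ =>
      EReal.sub_le_sub p.infRateAux_le_infRateActAux le_rfl
  have h3 : (⨆ (𝒰 : Type) (_ : MeasurableSpace 𝒰) (p : ISAC.AuxProcess M 𝒰)
      (_ : p.MeetsDistortion D), p.infRateActAux - p.supRateCond) ≤ M.avgCapacity D :=
    iSup₂_le fun _ _ => iSup₂_le fun p hp => EReal.ge_of_forall_gt_iff_ge.1 fun R hR =>
      le_sSup ⟨R, p.avgAchievable_of_lt hM hp hR, rfl⟩
  exact ⟨le_antisymm (h1.trans h2) h3, le_antisymm h1 (h2.trans h3)⟩
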